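/- **Setting.** Let $0<\varepsilon<R$, $B>0$, $N\ge 1$, and $c=\varepsilon/\sqrt{\varepsilon^2+B^2}$. Let $\Psi_0,\Psi_1,\dots$ be the functions obtained by Gram–Schmidt orthonormalization in $L_2(0,B)$ of $z_0^n e^{z_0}$, $n\ge 0$, and let $A_N=(a_{ms})_{m,s=0}^{N-1}$ with $a_{ms}=\int_0^B\Psi_m\Psi_s'\,dz_0$. For integers $n,k\ge 1$ put $h_\varphi=2\pi/n$, $h_z=B/k$, $\varphi_i=ih_\varphi$ $(0\le i\le n)$, $z_j=jh_z$ $(0\le j\le k)$. A semi-discrete function $V^h$ assigns to every node $(\varphi_i,z_j)$ an $\mathbb R^N$-valued function $V^h(r,\varphi_i,z_j)$ of $r\in(\varepsilon,R)$; equalities and inequalities between such functions hold for almost every $r$. Its difference quotients are $V^h_z=\big(V^h(r,\varphi_i,z_{j+1})-V^h(r,\varphi_i,z_{j-1})\big)/(2h_z)$ for $1\le j\le k-1$, and $V^h_\varphi=\big(V^h(r,\varphi_{i+1},z_j)-V^h(r,\varphi_{i-1},z_j)\big)/(2h_\varphi)$ for $0\le i\le n$, where $\varphi_{-1},\varphi_{n+1}$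 are read as $\varphi_{n-1},\varphi_1$. The space $H_N^{1,h}(D^h)$ consists of the $V^h$ with components in $L_2(\varepsilon,R)$, with norm $$\|V^h\|^2=\|V^h_z\|_{L^h_{2,N}}^2+\|V^h_\varphi\|_{L^h_{2,N}}^2+\|V^h\|_{L^h_{2,N}}^2 ,$$ where $\|\cdot\|_{L^h_{2,N}}^2$ is the sum over the nodes (those with $1\le j\le k-1$ for $V_z^h$) of $\int_\varepsilon^R|\cdot|^2dr$. Put $u^h(r,\varphi_i,z_j,z_0)=\sum_{s=0}^{N-1}V^h_s(r,\varphi_i,z_j)\Psi_s(z_0)$ and let $u^h_\varphi,u^h_z$ be the same sums formed with $V^h_\varphi,V^h_z$. Let $p(\varphi,z,z_0)=\sum_{s=0}^{N-1}p_s(\varphi,z)\Psi_s(z_0)$, where the $p_s$ are of class $C^1$ for $z\in[0,B]$, $2\pi$-periodic in $\varphi$, and $|\partial_\varphi p_s|,|\partial_z p_s|\le\Lambda$. For $x\in\{\varphi,z\}$ put $F^x(r,z_0)=-\frac12\int_r^R\frac{u^h_x(t,\cdot,z_0)}{\sqrt{u^h(t,\cdot,z_0)}}dt+p_x(\cdot,z_0)$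 at each node with $1\le j\le k-1$, and let $S=S(V^h_\varphi,V^h_z,r)\in\mathbb R^N$ have the components $$S_s=\frac1{r^2}T_s[F^\varphi(r,\cdot)]+T_s[F^z(r,\cdot)],\qquad T_s[f]=\Psi_s(B)f(B)^2-\Psi_s(0)f(0)^2-\int_0^B\Psi_s'(z_0)f(z_0)^2dz_0 .$$ For $\lambda>0$ let $$J_\lambda(V^h)=\sum_{i=0}^n\sum_{j=1}^{k-1}\int_\varepsilon^R\big|A_NV^h+S(V^h_\varphi,V^h_z,r)\big|^2e^{2\lambda r}dr .$$ For boundary data $G_0(r,\varphi_i),G_B(r,\varphi_i)$ and $M>0$ let $B(M)$ be the set of $V^h\in H^{1,h}_N(D^h)$ such that $u^h\ge c$ for all nodes and all $z_0\in[0,B]$, $\|V^h\|<M$, $V^h(r,\varphi_i,0)=G_0$, $V^h(r,\varphi_i,B)=G_B$, and $V^h(r,\varphi_0,z_j)=V^h(r,\varphi_n,z_j)$. Let $\overline{B(M)}$ be its closure in $H_N^{1,h}(D^h)$, and let $B^*(M)$ be the same set for the noiseless data $G_0^*,G_B^*$. **Theorem 8.2.** Let $\varepsilon,R,B,N$, $h_0>0$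 and $\Lambda$ be given. There is a function $\lambda_0=\lambda_0(M)\ge1$, nondecreasing in $M$, and for every $M>0$ a number $C>0$, with $\lambda_0(M)$ and $C$ depending only on $M$ and on these parameters, such that the following holds for all grids with $h_\varphi,h_z\ge h_0$ and all $p$ as above. Let $V^{h*}\in B^*(M)$ be an exact solution, i.e. $A_NV^{h*}+S(V^{h*}_\varphi,V^{h*}_z,r)=0$ at all nodes with $1\le j\le k-1$. Let $\delta\in(0,1)$, and suppose that there are $P^h,P^{h*}\in H_N^{1,h}(D^h)$ with $$P^h|_{z=0}=G_0,\quad P^h|_{z=B}=G_B,\quad P^{h*}|_{z=0}=G_0^*,\quad P^{h*}|_{z=B}=G_B^*,$$ $$\|P^h\|<M,\qquad\|P^{h*}\|<M,\qquad\|P^h-P^{h*}\|<\delta .$$ Suppose that $\|V^{h*}\|<M-\alpha$ with $\alpha\in(0,M)$ and $C\delta<\alpha$. Then for every $\lambda\ge\lambda_1:=\lambda_0(2M)$ every minimizer $V^h_{\min,\lambda}\in\overline{B(M)}$ of $J_\lambda$ on $\overline{B(M)}$ satisfies $$\|V^h_{\min,\lambda}-V^{h*}\|_{H_N^{1,h}(D^h)}\le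 C\delta .$$ -/

import Mathlib

open MeasureTheory Set

noncomputable section

namespace TravelTime

/-! ### The orthonormal basis of `L₂(0, B)` -/

/-- Gram-Schmidt orthogonalization in `L₂(0, B)` of the functions `z ↦ z ^ n * exp z`. -/
def gramSchmidtExp (B : ℝ) : ℕ → ℝ → ℝ
  | n => fun z =>
      z ^ n * Real.exp z -
        ∑ m : Fin n,
          (∫ x in (0 : ℝ)..B, x ^ n * Real.exp x * gramSchmidtExp B m.val x) /
            (∫ x in (0 : ℝ)..B, gramSchmidtExp B m.val x ^ 2) * gramSchmidtExp B m.val z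
  termination_by n => n
  decreasing_by all_goals exact m.isLt

/-- The normalized Gram-Schmidt functions `Ψ_n`. -/
def Psi (B : ℝ) (n : ℕ) (z : ℝ) : ℝ :=
  gramSchmidtExp B n z / √(∫ x in (0 : ℝ)..B, gramSchmidtExp B n x ^ 2)

/-- The matrix `A_N`, with entries `∫₀ᴮ Ψ_m Ψ_s'` for `0 ≤ m, s ≤ N - 1`. -/
def basisMatrix (B : ℝ) (N : ℕ) : Matrix (Fin N) (Fin N) ℝ :=
  fun m s => ∫ x in (0 : ℝ)..B, Psi B m x * deriv (Psi B s) x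

/-! ### Semi-discrete vector functions and partial finite differences -/

/-- Semi-discrete `N`-vector functions: `V i j s r` is the `s`-th component of `V` at the point
`(r, φ_i, z_j)`, where `φ_i = i h_φ` (`0 ≤ i ≤ n`) and `z_j = j h_z` (`0 ≤ j ≤ k`), with
`h_φ = 2 π / n` and `h_z = B / k`. -/
abbrev SemiDiscrete (N n k : ℕ) : Type := Fin (n + 1) → Fin (k + 1) → Fin N → ℝ → ℝ

/-- Semi-discrete boundary data on one of the faces `z = 0`, `z = B`. -/
abbrev FaceData (N n : ℕ) : Type := Fin (n + 1) → Fin N → ℝ → ℝ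

def stepPhi (n : ℕ) : ℝ := 2 * Real.pi / n

def stepZ (B : ℝ) (k : ℕ) : ℝ := B / k

/-- The successor of `φ_i` on the periodic grid, where `φ_0` and `φ_n` are identified. -/
def nextPhi {n : ℕ} (i : Fin (n + 1)) : Fin (n + 1) := if i = Fin.last n then 1 else i + 1

/-- The predecessor of `φ_i` on the periodic grid, where `φ_0` and `φ_n` are identified. -/
def prevPhi {n : ℕ} (i : Fin (n + 1)) : Fin (n + 1) := if i = 0 then Fin.last n - 1 else i - 1

/-- The nodes `z_1, …, z_{k-1}`, at which the difference quotient in `z` is defined. -/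
def IsInteriorZ {k : ℕ} (j : Fin (k + 1)) : Prop := j ≠ 0 ∧ j ≠ Fin.last k

instance {k : ℕ} (j : Fin (k + 1)) : Decidable (IsInteriorZ j) := by
  unfold IsInteriorZ; infer_instance

/-- Centred difference quotient in `φ`, periodic at `i = 0` and `i = n`. -/
def dPhi {N n k : ℕ} (V : SemiDiscrete N n k) : SemiDiscrete N n k := fun i j s r =>
  (V (nextPhi i) j s r - V (prevPhi i) j s r) / (2 * stepPhi n)

/-- Centred difference quotient in `z` at the nodes `z_1, …, z_{k-1}`. It does not exist at
`z_0` and `z_k`; the value `0` there means that these nodes do not contribute to its norm. -/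
def dZ (B : ℝ) {N n k : ℕ} (V : SemiDiscrete N n k) : SemiDiscrete N n k := fun i j s r =>
  if IsInteriorZ j then (V i (j + 1) s r - V i (j - 1) s r) / (2 * stepZ B k) else 0

/-- The space `H_N^{1,h}(D^h)`, which as a set is the space `L_{2,N}^h(D^h)`. -/
def InH1h (ε R : ℝ) {N n k : ℕ} (V : SemiDiscrete N n k) : Prop :=
  ∀ i j s, MemLp (V i j s) 2 (volume.restrict (Ioo ε R))

/-- The squared norm of `L_{2,N}^h(D^h)`. -/
def normSqL2h (ε R : ℝ) {N n k : ℕ} (V : SemiDiscrete N n k) : ℝ :=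
  ∑ i, ∑ j, ∑ s, ∫ r in ε..R, V i j s r ^ 2

/-- The norm of `H_N^{1,h}(D^h)`. -/
def normH1h (ε R B : ℝ) {N n k : ℕ} (V : SemiDiscrete N n k) : ℝ :=
  √(normSqL2h ε R (dZ B V) + normSqL2h ε R (dPhi V) + normSqL2h ε R V)

/-- `V(r, φ_i, 0) = G₀(r, φ_i)` and `V(r, φ_i, B) = G_B(r, φ_i)`. -/
def HasFaceData (ε R : ℝ) {N n k : ℕ} (G₀ G_B : FaceData N n) (V : SemiDiscrete N n k) : Prop :=
  ∀ i s, V i 0 s =ᵐ[volume.restrict (Ioo ε R)] G₀ i s ∧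
    V i (Fin.last k) s =ᵐ[volume.restrict (Ioo ε R)] G_B i s

/-- `V(r, φ_0, z_j) = V(r, φ_n, z_j)`. -/
def IsPeriodicPhi (ε R : ℝ) {N n k : ℕ} (V : SemiDiscrete N n k) : Prop :=
  ∀ j s, V 0 j s =ᵐ[volume.restrict (Ioo ε R)] V (Fin.last n) j s

/-! ### The functional -/

/-- The truncated series `∑_s V_s(r, φ_i, z_j) Ψ_s(z₀)`. -/
def series (B : ℝ) {N n k : ℕ} (V : SemiDiscrete N n k) (i : Fin (n + 1)) (j : Fin (k + 1))
    (z₀ r : ℝ) : ℝ :=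
  ∑ s, V i j s r * Psi B s z₀

/-- The expression `-1/2 ∫_r^R u_x / √u dt + p_x` at a node, for `x = φ` or `x = z`. Here `u` is
the series with coefficients `V`, `u_x` the series with coefficients `DV`, and `dp` are the
coefficients of `p_x` at the node. -/
def bracket (R B : ℝ) {N n k : ℕ} (V DV : SemiDiscrete N n k) (dp : Fin N → ℝ)
    (i : Fin (n + 1)) (j : Fin (k + 1)) (r z₀ : ℝ) : ℝ :=
  -(1 / 2) * (∫ t in r..R, series B DV i j z₀ t / √(series B V i j z₀ t)) +
    ∑ s, dp s * Psi B s z₀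

/-- `Ψ_s(B) f(B)² - Ψ_s(0) f(0)² - ∫₀ᴮ Ψ_s'(z₀) f(z₀)² dz₀`. -/
def projDerivSq (B : ℝ) (s : ℕ) (f : ℝ → ℝ) : ℝ :=
  Psi B s B * f B ^ 2 - Psi B s 0 * f 0 ^ 2 -
    ∫ z₀ in (0 : ℝ)..B, deriv (Psi B s) z₀ * f z₀ ^ 2

/-- The `m`-th component of `S(V_φ, V_z, r) = S^φ + S^z` at the node `(φ_i, z_j)`. The functions
`p s φ z` are the coefficients of the boundary travel time
`p(φ, z, z₀) = ∑_s p_s(φ, z) Ψ_s(z₀)`. -/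
def nonlinearTerm (R B : ℝ) {N n k : ℕ} (p : Fin N → ℝ → ℝ → ℝ) (V : SemiDiscrete N n k)
    (i : Fin (n + 1)) (j : Fin (k + 1)) (m : Fin N) (r : ℝ) : ℝ :=
  1 / r ^ 2 * projDerivSq B m (bracket R B V (dPhi V)
      (fun s => deriv (fun φ => p s φ (j * stepZ B k)) (i * stepPhi n)) i j r) +
    projDerivSq B m (bracket R B V (dZ B V)
      (fun s => deriv (fun z => p s (i * stepPhi n) z) (j * stepZ B k)) i j r)

/-- The `m`-th component of `A_N V + S(V_φ, V_z, r)` at the node `(φ_i, z_j)`. -/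
def residual (R B : ℝ) {N n k : ℕ} (p : Fin N → ℝ → ℝ → ℝ) (V : SemiDiscrete N n k)
    (i : Fin (n + 1)) (j : Fin (k + 1)) (m : Fin N) (r : ℝ) : ℝ :=
  (basisMatrix B N).mulVec (fun s => V i j s r) m + nonlinearTerm R B p V i j m r

/-- The functional `J_λ`. The sum is over the nodes at which the residual is defined. -/
def functionalJ (ε R B : ℝ) {N n k : ℕ} (p : Fin N → ℝ → ℝ → ℝ) (lam : ℝ)
    (V : SemiDiscrete N n k) : ℝ :=
  ∑ i, ∑ j, if IsInteriorZ j then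
    ∑ m, ∫ r in ε..R, (residual R B p V i j m r * Real.exp (lam * r)) ^ 2 else 0

/-- The semi-discrete equation `A_N V + S(V_φ, V_z, r) = 0`. -/
def SolvesEquation (ε R B : ℝ) {N n k : ℕ} (p : Fin N → ℝ → ℝ → ℝ)
    (V : SemiDiscrete N n k) : Prop :=
  ∀ i j, IsInteriorZ j → ∀ m,
    ∀ᵐ r ∂(volume.restrict (Ioo ε R)), residual R B p V i j m r = 0

/-! ### The admissible sets -/

/-- The number `c`. -/
def lowerBound (ε B : ℝ) : ℝ := ε / √(ε ^ 2 + B ^ 2)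

/-- The set `B(M)` for the boundary data `G₀, G_B`. -/
def admissible (ε R B M : ℝ) {N n : ℕ} (k : ℕ) (G₀ G_B : FaceData N n) :
    Set (SemiDiscrete N n k) :=
  {V | InH1h ε R V ∧
    (∀ i j, ∀ᵐ r ∂(volume.restrict (Ioo ε R)), ∀ z₀ ∈ Icc 0 B,
      lowerBound ε B ≤ series B V i j z₀ r) ∧
    normH1h ε R B V < M ∧ HasFaceData ε R G₀ G_B V ∧ IsPeriodicPhi ε R V}

/-- Closure of a set in `H_N^{1,h}(D^h)`. -/
def closureH1h (ε R B : ℝ) {N n k : ℕ} (X : Set (SemiDiscrete N n k)) :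
    Set (SemiDiscrete N n k) :=
  {V | InH1h ε R V ∧ ∀ η > 0, ∃ W ∈ X, normH1h ε R B (V - W) < η}

/-- Admissible coefficients of the boundary travel time: `2π`-periodic in `φ`, of class `C¹`, with
first order derivatives at most `Λ` in absolute value. -/
def IsTravelTimeData (B Λ : ℝ) {N : ℕ} (p : Fin N → ℝ → ℝ → ℝ) : Prop :=
  ∀ s, ContDiffOn ℝ 1 (fun x : ℝ × ℝ => p s x.1 x.2) (univ ×ˢ Icc 0 B) ∧
    (∀ z ∈ Icc 0 B, Function.Periodic (fun φ => p s φ z) (2 * Real.pi)) ∧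
    ∀ φ, ∀ z ∈ Ioo 0 B,
      |deriv (fun φ' => p s φ' z) φ| ≤ Λ ∧ |deriv (fun z' => p s φ z') z| ≤ Λ

end TravelTime

end

noncomputable section

namespace TravelTime

/-! ### The Gram-Schmidt functions -/

/-! The equation is of Volterra type in `r`: the nonlinear term at `r` only involves the values of
the unknown on `[r, R]`, while the linear part is the matrix `A_N`. That matrix is upper triangular
with unit diagonal (`det_basisMatrix`), because differentiating a polynomial times `exp` reproduces
the function up to a polynomial factor of smaller degree. Since the steps are at least `h₀`, there
are boundedly many nodes and difference quotients are bounded operators.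

Let `f(r)` be the squared error of a minimizer `V` at the interior nodes and `q(r)` its squared
residual there. The squared error on the faces has integral at most `δ²`, because there `V - V*` has
the traces of `P - P*`. Subtracting the exact equation and inverting `A_N` gives `f(r) ≤ K (q(r) +
δ² + ∫_r^R f)` (`Setting.ae_interiorSq_sub_le`).

To control `q`, `V` is compared with the function equal to `V*` at the interior nodes for `r ≤ ρ`
and to `V` elsewhere (`splice`). No derivative in `r` occurs, so such a cut stays in the space.
Above `ρ` both residuals agree by the Volterra structure. Below `ρ` the residual of the competitor
is a difference of nonlinear terms only, with square at most a constant times `δ² + ∫_ρ^R f`.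
Minimality then bounds `∫_ε^ρ q e^{2λr}` (`Setting.integral_residual_le_of_functionalJ_le`).

Inserted in the weighted integral of the first inequality, with the Volterra term absorbed for `λ ≥
K`, this shows that going down by a strip of width `1/λ` multiplies `δ² + ∫_ρ^R f` by at most `1 +
D/λ` (`integral_strip_le`). About `λ (R - ε)` strips are needed, so the total growth is bounded
independently of `λ` (`integral_le_gronwallFactor`).

The competitor must have norm below `M`. This is a bootstrap: the bound already obtained on `[ρ, R]`
puts it within `C δ < α` of `V*`, hence inside the ball, so the comparison is available exactly
where the next step uses it. Convexity of the functional plays no role. -/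

theorem gramSchmidtExp_eq (B : ℝ) (n : ℕ) (z : ℝ) :
    gramSchmidtExp B n z = z ^ n * Real.exp z -
        ∑ m ∈ Finset.range n,
          (∫ x in (0 : ℝ)..B, x ^ n * Real.exp x * gramSchmidtExp B m x) /
            (∫ x in (0 : ℝ)..B, gramSchmidtExp B m x ^ 2) * gramSchmidtExp B m z := by
  rw [gramSchmidtExp, Finset.sum_range]

open Polynomial in
-- Every subtracted function is `exp` times a polynomial of degree below `n`, so the leading term `X
-- ^ n` survives.
theorem exists_monic_gramSchmidtExp (B : ℝ) (n : ℕ) :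
    ∃ q : ℝ[X], q.Monic ∧ q.degree = n ∧
      ∀ z, gramSchmidtExp B n z = q.eval z * Real.exp z := by
  induction n using Nat.strong_induction_on with
  | _ n ih =>
    choose! q hq hdeg hval using ih
    set t : ℝ[X] := ∑ m ∈ Finset.range n,
      C ((∫ x in (0 : ℝ)..B, x ^ n * Real.exp x * gramSchmidtExp B m x) /
            (∫ x in (0 : ℝ)..B, gramSchmidtExp B m x ^ 2)) * q m with ht
    have htdeg : t.degree < ((X : ℝ[X]) ^ n).degree := by
      rw [degree_X_pow]
      refine (degree_sum_le _ _).trans_lt ?_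
      refine (Finset.sup_lt_iff (WithBot.bot_lt_coe n)).2 ?_
      intro m hm
      have hm' := Finset.mem_range.1 hm
      refine (degree_mul_le _ _).trans_lt ((add_le_add_left degree_C_le _).trans_lt ?_)
      rw [hdeg m hm', zero_add]
      exact Nat.cast_lt.2 hm'
    refine ⟨X ^ n - t, (monic_X_pow n).sub_of_left htdeg, ?_, fun z => ?_⟩
    · rw [degree_sub_eq_left_of_degree_lt htdeg, degree_X_pow]
    · rw [gramSchmidtExp_eq, eval_sub, eval_pow, eval_X, ht, eval_finsetSum, sub_mul,
        Finset.sum_mul]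
      congr 1
      refine Finset.sum_congr rfl fun m hm => ?_
      rw [eval_mul, eval_C, hval m (Finset.mem_range.1 hm), mul_assoc]

theorem contDiff_gramSchmidtExp (B : ℝ) (n : ℕ) : ContDiff ℝ 1 (gramSchmidtExp B n) := by
  obtain ⟨q, -, -, hq⟩ := exists_monic_gramSchmidtExp B n
  rw [funext hq]
  have h : ContDiff ℝ 1 fun z => q.eval z := by
    simpa [Polynomial.aeval_def] using q.contDiff_aeval (𝕜 := ℝ) 1
  exact h.mul Real.contDiff_exp

theorem continuous_gramSchmidtExp (B : ℝ) (n : ℕ) : Continuous (gramSchmidtExp B n) :=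
  (contDiff_gramSchmidtExp B n).continuous

/-- A monic polynomial has finitely many roots and `Ioo 0 B` is infinite, so the continuous square
is positive somewhere. Thus the divisions in the recursion and in the normalization are genuine. -/
theorem integral_gramSchmidtExp_sq_pos {B : ℝ} (hB : 0 < B) (n : ℕ) :
    0 < ∫ x in (0 : ℝ)..B, gramSchmidtExp B n x ^ 2 := by
  obtain ⟨q, hmon, -, hq⟩ := exists_monic_gramSchmidtExp B n
  have : ∃ x ∈ Ioo 0 B, q.eval x ≠ 0 := by
    by_contra! h
    exact (Ioo_infinite hB) ((q.roots.toFinset.finite_toSet).subset fun x hx => by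
      simp [hmon.ne_zero, h x hx])
  obtain ⟨x, hx, hne⟩ := this
  refine intervalIntegral.integral_pos hB
    ((continuous_gramSchmidtExp B n).pow 2).continuousOn (fun _ _ => sq_nonneg _)
    ⟨x, ⟨hx.1.le, hx.2.le⟩, ?_⟩
  rw [hq]
  have := Real.exp_pos x
  positivity

/-- When the recursion is integrated against an earlier function, the induction hypothesis leaves
only the term `l = m` of the sum, and this cancels the projection of the new function. -/
theorem integral_gramSchmidtExp_mul_eq_zero {B : ℝ} (hB : 0 < B) (n : ℕ) :
    ∀ m < n, ∫ x in (0 : ℝ)..B, gramSchmidtExp B n x * gramSchmidtExp B m x = 0 := by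
  induction n using Nat.strong_induction_on with
  | _ n ih =>
    intro m hm
    have hc := continuous_gramSchmidtExp B
    have orth : ∀ l < n, l ≠ m →
        ∫ x in (0 : ℝ)..B, gramSchmidtExp B l x * gramSchmidtExp B m x = 0 := by
      intro l hl hne
      rcases lt_or_gt_of_ne hne with h | h
      · simpa only [mul_comm] using ih m hm l h
      · exact ih l hl m h
    have e : ∀ x, gramSchmidtExp B n x * gramSchmidtExp B m x =
        x ^ n * Real.exp x * gramSchmidtExp B m x -
        ∑ l ∈ Finset.range n,
          (∫ x in (0 : ℝ)..B, x ^ n * Real.exp x * gramSchmidtExp B l x) /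
            (∫ x in (0 : ℝ)..B, gramSchmidtExp B l x ^ 2) *
            (gramSchmidtExp B l x * gramSchmidtExp B m x) := by
      intro x
      rw [gramSchmidtExp_eq B n, sub_mul, Finset.sum_mul]
      simp only [mul_assoc]
    simp only [e]
    rw [intervalIntegral.integral_sub, intervalIntegral.integral_finsetSum,
      Finset.sum_eq_single m]
    · rw [intervalIntegral.integral_const_mul]
      have h0 := (integral_gramSchmidtExp_sq_pos hB m).ne'
      simp only [← pow_two]
      rw [div_mul_cancel₀ _ h0, sub_self]
    · intro l hl hne
      rw [intervalIntegral.integral_const_mul, orth l (Finset.mem_range.1 hl) hne, mul_zero]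
    · intro h
      exact absurd (Finset.mem_range.2 hm) h
    · intro l _
      exact (((hc l).mul (hc m)).const_mul _).intervalIntegrable _ _
    · exact (((continuous_id.pow n).mul Real.continuous_exp).mul (hc m)).intervalIntegrable _ _
    · exact (continuous_finsetSum _ fun l _ =>
        ((hc l).mul (hc m)).const_mul _).intervalIntegrable _ _

open Polynomial in
-- Induction on the degree bound: a multiple of the monic polynomial of the `d`-th function removes
-- the coefficient of degree `d`, and that function is already known to be orthogonal to the `n`-th
-- one.
theorem integral_gramSchmidtExp_mul_poly {B : ℝ} (hB : 0 < B) (n : ℕ) :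
    ∀ d ≤ n, ∀ t : ℝ[X], t.degree < d →
      ∫ x in (0 : ℝ)..B, gramSchmidtExp B n x * (t.eval x * Real.exp x) = 0 := by
  intro d
  induction d with
  | zero =>
    intro _ t ht
    have : t = 0 := by simpa using ht
    simp [this]
  | succ d ih =>
    intro hd t ht
    obtain ⟨q, hmon, hdeg, hq⟩ := exists_monic_gramSchmidtExp B d
    have hlt : (t - C (t.coeff d) * q).degree < d := by
      rw [degree_lt_iff_coeff_zero]
      intro m hm
      rcases hm.eq_or_lt with rfl | hm
      · have : q.coeff d = 1 := by
          have := hmon.leadingCoeff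
          rwa [leadingCoeff, natDegree_eq_of_degree_eq_some hdeg] at this
        simp [this]
      · have h1 : t.coeff m = 0 := coeff_eq_zero_of_degree_lt (ht.trans_le (by exact_mod_cast hm))
        have h2 : q.coeff m = 0 :=
          coeff_eq_zero_of_degree_lt (by rw [hdeg]; exact_mod_cast hm)
        simp [h1, h2]
    have h1 := ih (by omega) _ hlt
    have h2 := integral_gramSchmidtExp_mul_eq_zero hB n d (by omega)
    have e : ∀ x, gramSchmidtExp B n x * (t.eval x * Real.exp x) =
        gramSchmidtExp B n x * ((t - C (t.coeff d) * q).eval x * Real.exp x) +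
          t.coeff d * (gramSchmidtExp B n x * gramSchmidtExp B d x) := by
      intro x
      rw [hq, eval_sub, eval_mul, eval_C]
      ring
    have hc := continuous_gramSchmidtExp B
    simp only [e]
    rw [intervalIntegral.integral_add, h1, intervalIntegral.integral_const_mul, h2, mul_zero,
      add_zero]
    · exact ((hc n).mul ((Polynomial.continuous _).mul Real.continuous_exp)).intervalIntegrable _ _
    · exact (((hc n).mul (hc d)).const_mul _).intervalIntegrable _ _

theorem contDiff_Psi (B : ℝ) (n : ℕ) : ContDiff ℝ 1 (Psi B n) :=
  (contDiff_gramSchmidtExp B n).div_const _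

theorem continuous_Psi (B : ℝ) (n : ℕ) : Continuous (Psi B n) := (contDiff_Psi B n).continuous

theorem continuous_deriv_Psi (B : ℝ) (n : ℕ) : Continuous (deriv (Psi B n)) :=
  (contDiff_Psi B n).continuous_deriv le_rfl

/-- A common bound of the basis functions and of their derivatives. -/
theorem exists_bound_Psi (B : ℝ) (N : ℕ) :
    ∃ K : ℝ, 0 ≤ K ∧ ∀ s : Fin N, ∀ z ∈ Icc 0 B, |Psi B s z| ≤ K ∧ |deriv (Psi B s) z| ≤ K := by
  have h : ∀ s : Fin N, ∃ K : ℝ, 0 ≤ K ∧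
      ∀ z ∈ Icc 0 B, |Psi B s z| ≤ K ∧ |deriv (Psi B s) z| ≤ K := by
    intro s
    obtain ⟨K₁, h₁⟩ := isCompact_Icc.exists_bound_of_continuousOn
      (continuous_Psi B s).continuousOn (s := Icc 0 B)
    obtain ⟨K₂, h₂⟩ := isCompact_Icc.exists_bound_of_continuousOn
      (continuous_deriv_Psi B s).continuousOn (s := Icc 0 B)
    exact ⟨max 0 (max K₁ K₂), le_max_left _ _, fun z hz =>
      ⟨(h₁ z hz).trans (by simp), (h₂ z hz).trans (by simp)⟩⟩
  choose K hK hb using h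
  refine ⟨∑ s, K s, Finset.sum_nonneg fun s _ => hK s, fun s z hz => ?_⟩
  have := Finset.single_le_sum (fun s _ => hK s) (Finset.mem_univ s)
  exact ⟨(hb s z hz).1.trans this, (hb s z hz).2.trans this⟩

/-! ### Invertibility of the matrix `A_N` -/

open Polynomial in
-- The derivative of `q * exp` is `q * exp + q' * exp`. The second summand has a polynomial factor
-- of degree below `s ≤ m`, hence is orthogonal to `Psi B m`, and what remains is the orthonormality
-- relation.
theorem integral_Psi_mul_deriv_Psi {B : ℝ} (hB : 0 < B) {m s : ℕ} (h : s ≤ m) :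
    ∫ x in (0 : ℝ)..B, Psi B m x * deriv (Psi B s) x = if s = m then 1 else 0 := by
  obtain ⟨q, hmon, hdeg, hq⟩ := exists_monic_gramSchmidtExp B s
  set a := √(∫ x in (0 : ℝ)..B, gramSchmidtExp B m x ^ 2) with ha
  set b := √(∫ x in (0 : ℝ)..B, gramSchmidtExp B s x ^ 2) with hb
  have hd : ∀ x, deriv (Psi B s) x =
      (gramSchmidtExp B s x + q.derivative.eval x * Real.exp x) / b := by
    intro x
    have h1 : Psi B s = fun z => q.eval z * Real.exp z / b := by
      funext z; rw [Psi, hq]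
    have h2 : HasDerivAt (fun z => q.eval z * Real.exp z / b)
        ((q.derivative.eval x * Real.exp x + q.eval x * Real.exp x) / b) x :=
      ((q.hasDerivAt x).mul (Real.hasDerivAt_exp x)).div_const b
    rw [h1, h2.deriv, hq, add_comm]
  have e : ∀ x, Psi B m x * deriv (Psi B s) x =
      (1 / (a * b)) * (gramSchmidtExp B m x * gramSchmidtExp B s x) +
        (1 / (a * b)) * (gramSchmidtExp B m x * (q.derivative.eval x * Real.exp x)) := by
    intro x
    rw [hd, Psi]
    ring
  have hc := continuous_gramSchmidtExp B
  simp only [e]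
  have hlt : q.derivative.degree < s := by
    rw [← hdeg]; exact degree_derivative_lt hmon.ne_zero
  rw [intervalIntegral.integral_add, intervalIntegral.integral_const_mul,
    intervalIntegral.integral_const_mul, integral_gramSchmidtExp_mul_poly hB m s h _ hlt,
    mul_zero, add_zero]
  · split_ifs with hs
    · subst hs
      have h0 := integral_gramSchmidtExp_sq_pos hB s
      simp only [← pow_two]
      have hab : a * b = ∫ x in (0 : ℝ)..B, gramSchmidtExp B s x ^ 2 := Real.mul_self_sqrt h0.le
      rw [hab, one_div, inv_mul_cancel₀ h0.ne']
    · rw [integral_gramSchmidtExp_mul_eq_zero hB m s (by omega), mul_zero]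
  · exact (((hc m).mul (hc s)).const_mul _).intervalIntegrable _ _
  · exact (((hc m).mul ((Polynomial.continuous _).mul Real.continuous_exp)).const_mul
      _).intervalIntegrable _ _

theorem det_basisMatrix {B : ℝ} (hB : 0 < B) (N : ℕ) : (basisMatrix B N).det = 1 := by
  rw [Matrix.det_of_isUpperTriangular]
  · refine Finset.prod_eq_one fun i _ => ?_
    rw [basisMatrix, integral_Psi_mul_deriv_Psi hB le_rfl, if_pos rfl]
  · intro i j hij
    have h : (j : ℕ) < i := hij
    rw [basisMatrix, integral_Psi_mul_deriv_Psi hB h.le, if_neg h.ne]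

theorem exists_sum_sq_le_mulVec_basisMatrix {B : ℝ} (hB : 0 < B) (N : ℕ) :
    ∃ κ : ℝ, 0 ≤ κ ∧ ∀ v : Fin N → ℝ,
      ∑ s, v s ^ 2 ≤ κ * ∑ m, (basisMatrix B N).mulVec v m ^ 2 := by
  set A := basisMatrix B N
  have hA : IsUnit A.det := by rw [det_basisMatrix hB]; exact isUnit_one
  -- The constant is the squared Frobenius norm of the inverse; Cauchy–Schwarz is applied row by
  -- row.
  refine ⟨∑ s, ∑ m, A⁻¹ s m ^ 2, by positivity, fun v => ?_⟩
  rw [Finset.sum_mul]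
  refine Finset.sum_le_sum fun s _ => ?_
  have hv : v s = ∑ m, A⁻¹ s m * A.mulVec v m := by
    change v s = A⁻¹.mulVec (A.mulVec v) s
    rw [Matrix.mulVec_mulVec, Matrix.nonsing_inv_mul _ hA, Matrix.one_mulVec]
  rw [hv]
  exact Finset.sum_mul_sq_le_sq_mul_sq _ _ _

/-! ### A weighted Gronwall argument -/

/-- Integration by parts against the primitive `e^{2λr} / (2λ)`: the boundary term at `b` vanishes
and the one at `a` has the favourable sign. As `f` is merely integrable, the version for absolutely
continuous functions is used. The gain `1 / (2λ)` is what the weight contributes to the whole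
argument. -/
theorem integral_exp_mul_integral_le {a b lam : ℝ} (hab : a ≤ b) (hlam : 0 < lam) {f : ℝ → ℝ}
    (hf : IntervalIntegrable f volume a b) (hf0 : ∀ r, 0 ≤ f r) :
    ∫ r in a..b, (∫ t in r..b, f t) * Real.exp (2 * lam * r) ≤
      1 / (2 * lam) * ∫ r in a..b, f r * Real.exp (2 * lam * r) := by
  set g : ℝ → ℝ := fun r => Real.exp (2 * lam * r) / (2 * lam) with hg
  have hg' : ∀ r, HasDerivAt g (Real.exp (2 * lam * r)) r := by
    intro r
    have h := (((hasDerivAt_id r).const_mul (2 * lam)).exp).div_const (2 * lam)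
    convert! h using 1
    field_simp
    simp
  have hgd : ∀ r, deriv g r = Real.exp (2 * lam * r) := fun r => (hg' r).deriv
  have hgac : AbsolutelyContinuousOnInterval g a b := by
    refine ContDiffOn.absolutelyContinuousOnInterval (ContDiff.contDiffOn ?_)
    exact (Real.contDiff_exp.comp (contDiff_const.mul contDiff_id)).div_const _
  set h : ℝ → ℝ := fun r => ∫ t in b..r, f t with hh
  have hhac : AbsolutelyContinuousOnInterval h a b :=
    hf.absolutelyContinuousOnInterval_intervalIntegral (by simp)
  have hparts := hhac.integral_mul_deriv_eq_deriv_mul hgac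
  have hhd : ∫ r in a..b, deriv h r * g r = ∫ r in a..b, f r * g r := by
    refine intervalIntegral.integral_congr_ae ?_
    filter_upwards [hf.ae_hasDerivAt_integral] with r hr hr'
    rw [(hr (uIoc_subset_uIcc hr') b (by simp)).deriv]
  have hb : h b = 0 := by simp [hh]
  have ha : h a ≤ 0 := by
    simp only [hh]
    rw [intervalIntegral.integral_symm]
    have := intervalIntegral.integral_nonneg hab (fun r _ => hf0 r) (μ := volume)
    linarith
  have hga : 0 ≤ g a := by simp only [hg]; positivity
  rw [hhd, hb] at hparts
  have e1 : ∫ r in a..b, (∫ t in r..b, f t) * Real.exp (2 * lam * r) =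
      -∫ r in a..b, h r * deriv g r := by
    rw [← intervalIntegral.integral_neg]
    refine intervalIntegral.integral_congr fun r _ => ?_
    simp only [hh, hgd]
    rw [intervalIntegral.integral_symm r b]
    ring
  have e2 : ∫ r in a..b, f r * g r =
      1 / (2 * lam) * ∫ r in a..b, f r * Real.exp (2 * lam * r) := by
    rw [← intervalIntegral.integral_const_mul]
    refine intervalIntegral.integral_congr fun r _ => ?_
    simp only [hg]
    ring
  rw [e1, hparts, ← e2]
  nlinarith [mul_nonneg (neg_nonneg.2 ha) hga]

theorem integral_exp_two_mul_le {a b lam : ℝ} (hlam : 0 < lam) :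
    ∫ r in a..b, Real.exp (2 * lam * r) ≤ Real.exp (2 * lam * b) / (2 * lam) := by
  have h : ∀ r ∈ uIcc a b, HasDerivAt (fun r => Real.exp (2 * lam * r) / (2 * lam))
      (Real.exp (2 * lam * r)) r := by
    intro r _
    have h := (((hasDerivAt_id r).const_mul (2 * lam)).exp).div_const (2 * lam)
    convert! h using 1
    field_simp
    simp
  rw [intervalIntegral.integral_eq_sub_of_hasDerivAt h
    ((by fun_prop : Continuous fun r => Real.exp (2 * lam * r)).intervalIntegrable _ _)]
  have : 0 ≤ Real.exp (2 * lam * a) / (2 * lam) := by positivity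
  linarith

theorem continuous_exp_two_mul (lam : ℝ) : Continuous fun r : ℝ => Real.exp (2 * lam * r) := by
  fun_prop

/-- The step of the downward iteration. -/
theorem integral_strip_le {ε R K a lam ρ ρ' : ℝ} (hK : 0 ≤ K) (ha : 0 ≤ a)
    (hlam : 1 ≤ lam) (hKlam : K ≤ lam) {f q : ℝ → ℝ}
    (hf : IntervalIntegrable f volume ε R) (hq : IntervalIntegrable q volume ε R)
    (hf0 : ∀ r, 0 ≤ f r) 
    (hfq : ∀ᵐ r ∂(volume.restrict (Ioo ε R)), f r ≤ K * (q r + a + ∫ t in r..R, f t))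
    (hρ' : ε ≤ ρ') (hρρ' : ρ' ≤ ρ) (hρ : ρ ≤ R) (hstep : ρ - ρ' ≤ 1 / lam)
    (hmin : ∫ r in ε..ρ, q r * Real.exp (2 * lam * r) ≤
      K * (a + ∫ r in ρ..R, f r) * ∫ r in ε..ρ, Real.exp (2 * lam * r)) :
    ∫ r in ρ'..ρ, f r ≤ Real.exp 2 * (K * (K + 1)) / lam * (a + ∫ r in ρ..R, f r) := by
  have hlam0 : 0 < lam := by linarith
  have hερ : ε ≤ ρ := hρ'.trans hρρ'
  have hεR : ε ≤ R := hερ.trans hρ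
  have sub : ∀ {g : ℝ → ℝ} {x y : ℝ}, IntervalIntegrable g volume ε R → ε ≤ x → x ≤ R → ε ≤ y →
      y ≤ R → IntervalIntegrable g volume x y := by
    intro g x y hg hx hx' hy hy'
    refine hg.mono_set ?_
    rw [uIcc_of_le hεR]
    exact uIcc_subset_Icc ⟨hx, hx'⟩ ⟨hy, hy'⟩
  set E := a + ∫ r in ρ..R, f r with hE
  have hE0 : 0 ≤ E := add_nonneg ha (intervalIntegral.integral_nonneg hρ fun r _ => hf0 r)
  have hfρ := sub hf le_rfl hεR hερ hρ
  have hqρ := sub hq le_rfl hεR hερ hρ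
  have hexp := continuous_exp_two_mul lam
  set X := ∫ r in ε..ρ, f r * Real.exp (2 * lam * r) with hX
  have hfe : IntervalIntegrable (fun r => f r * Real.exp (2 * lam * r)) volume ε ρ :=
    hfρ.mul_continuousOn hexp.continuousOn
  have hqe : IntervalIntegrable (fun r => q r * Real.exp (2 * lam * r)) volume ε ρ :=
    hqρ.mul_continuousOn hexp.continuousOn
  have hprim : ContinuousOn (fun r => ∫ t in r..ρ, f t) (uIcc ε ρ) := by
    have := intervalIntegral.continuousOn_primitive_interval'
      (b₁ := ε) (b₂ := ρ) (a := ρ) hfρ (by simp)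
    refine this.neg.congr fun r _ => ?_
    exact intervalIntegral.integral_symm _ _
  have hpe : IntervalIntegrable (fun r => (∫ t in r..ρ, f t) * Real.exp (2 * lam * r))
      volume ε ρ := (hprim.mul hexp.continuousOn).intervalIntegrable
  have hee : IntervalIntegrable (fun r => Real.exp (2 * lam * r)) volume ε ρ :=
    hexp.intervalIntegrable _ _
  have key : X ≤ K * (∫ r in ε..ρ, q r * Real.exp (2 * lam * r)) +
      K * E * (∫ r in ε..ρ, Real.exp (2 * lam * r)) +
      K * ∫ r in ε..ρ, (∫ t in r..ρ, f t) * Real.exp (2 * lam * r) := by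
    rw [← intervalIntegral.integral_const_mul, ← intervalIntegral.integral_const_mul,
      ← intervalIntegral.integral_const_mul,
      ← intervalIntegral.integral_add (hqe.const_mul _) (hee.const_mul _),
      ← intervalIntegral.integral_add ((hqe.const_mul _).add (hee.const_mul _))
        (hpe.const_mul _)]
    refine intervalIntegral.integral_mono_ae_restrict hερ hfe
      (((hqe.const_mul _).add (hee.const_mul _)).add (hpe.const_mul _)) ?_
    have h1 : ∀ᵐ r ∂(volume.restrict (Icc ε ρ)), r ∈ Ioo ε ρ := by
      rw [← restrict_Ioo_eq_restrict_Icc]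
      exact ae_restrict_mem measurableSet_Ioo
    have h2 : ∀ᵐ r ∂(volume.restrict (Icc ε ρ)), f r ≤ K * (q r + a + ∫ t in r..R, f t) := by
      rw [← restrict_Ioo_eq_restrict_Icc]
      exact ae_restrict_of_ae_restrict_of_subset (Ioo_subset_Ioo_right hρ) hfq
    filter_upwards [h1, h2] with r hr h
    have hs : ∫ t in r..R, f t = (∫ t in r..ρ, f t) + ∫ t in ρ..R, f t :=
      (intervalIntegral.integral_add_adjacent_intervals
        (sub hf hr.1.le (hr.2.le.trans hρ) hερ hρ) (sub hf hερ hρ hεR le_rfl)).symm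
    have := mul_le_mul_of_nonneg_right h (Real.exp_pos (2 * lam * r)).le
    rw [hs] at this
    refine this.trans (le_of_eq ?_)
    rw [hE]
    ring
  have hI := integral_exp_two_mul_le (a := ε) (b := ρ) hlam0
  have hV := integral_exp_mul_integral_le hερ hlam0 hfρ hf0
  set I := ∫ r in ε..ρ, Real.exp (2 * lam * r)
  set Y := ∫ r in ε..ρ, (∫ t in r..ρ, f t) * Real.exp (2 * lam * r)
  have hX0 : 0 ≤ X := intervalIntegral.integral_nonneg hερ fun r _ =>
    mul_nonneg (hf0 r) (Real.exp_pos _).le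
  have hXb : X ≤ K * (K + 1) * E * (Real.exp (2 * lam * ρ) / lam) := by
    have h1 : K * (∫ r in ε..ρ, q r * Real.exp (2 * lam * r)) ≤ K * (K * E * I) :=
      mul_le_mul_of_nonneg_left hmin hK
    -- Since `K ≤ λ`, the Volterra term costs at most half of the left-hand side and can be
    -- absorbed.
    have h2 : K * Y ≤ X / 2 := by
      have : K * Y ≤ K * (1 / (2 * lam) * X) := mul_le_mul_of_nonneg_left hV hK
      have h3 : K * (1 / (2 * lam) * X) = K / lam * (X / 2) := by field_simp
      have h4 : K / lam ≤ 1 := (div_le_one hlam0).2 hKlam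
      nlinarith
    have h5 : K * (K + 1) * E * I ≤ K * (K + 1) * E * (Real.exp (2 * lam * ρ) / (2 * lam)) :=
      mul_le_mul_of_nonneg_left hI (by positivity)
    have h6 : K * (K + 1) * E * (Real.exp (2 * lam * ρ) / lam) =
        2 * (K * (K + 1) * E * (Real.exp (2 * lam * ρ) / (2 * lam))) := by field_simp
    rw [h6]
    nlinarith
  have hlow : Real.exp (2 * lam * ρ') * ∫ r in ρ'..ρ, f r ≤ X := by
    have e : X = (∫ r in ε..ρ', f r * Real.exp (2 * lam * r)) +
        ∫ r in ρ'..ρ, f r * Real.exp (2 * lam * r) :=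
      (intervalIntegral.integral_add_adjacent_intervals
        (hfe.mono_set (by rw [uIcc_of_le hερ]; exact uIcc_subset_Icc ⟨le_rfl, hερ⟩ ⟨hρ', hρρ'⟩))
        (hfe.mono_set (by rw [uIcc_of_le hερ]; exact uIcc_subset_Icc ⟨hρ', hρρ'⟩ ⟨hερ, le_rfl⟩))
        ).symm
    have h0 : 0 ≤ ∫ r in ε..ρ', f r * Real.exp (2 * lam * r) :=
      intervalIntegral.integral_nonneg hρ' fun r _ => mul_nonneg (hf0 r) (Real.exp_pos _).le
    rw [e, ← intervalIntegral.integral_const_mul]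
    have hfs := sub hf hρ' (hρρ'.trans hρ) hερ hρ
    have : ∫ r in ρ'..ρ, Real.exp (2 * lam * ρ') * f r ≤
        ∫ r in ρ'..ρ, f r * Real.exp (2 * lam * r) := by
      refine intervalIntegral.integral_mono_on hρρ' (hfs.const_mul _)
        (hfs.mul_continuousOn hexp.continuousOn) fun r hr => ?_
      rw [mul_comm]
      refine mul_le_mul_of_nonneg_left (Real.exp_le_exp.2 ?_) (hf0 r)
      nlinarith [hr.1]
    linarith
  -- On a strip of width at most `1/λ` the weight varies by a factor of at most `e²`, uniformly in
  -- `λ`. This dictates the step of the iteration.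
  have hexp2 : Real.exp (2 * lam * ρ) ≤ Real.exp 2 * Real.exp (2 * lam * ρ') := by
    rw [← Real.exp_add]
    refine Real.exp_le_exp.2 ?_
    have := mul_le_mul_of_nonneg_left hstep hlam0.le
    rw [mul_one_div_cancel hlam0.ne'] at this
    nlinarith
  have hp := Real.exp_pos (2 * lam * ρ')
  refine le_of_mul_le_mul_left ?_ hp
  calc Real.exp (2 * lam * ρ') * ∫ r in ρ'..ρ, f r
      ≤ K * (K + 1) * E * (Real.exp (2 * lam * ρ) / lam) := hlow.trans hXb
    _ ≤ K * (K + 1) * E * ((Real.exp 2 * Real.exp (2 * lam * ρ')) / lam) := by gcongr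
    _ = _ := by ring

/-- The factor of the final estimate, for a given Volterra constant `K`. -/
def gronwallFactor (ε R K : ℝ) : ℝ :=
  Real.exp (Real.exp 2 * (K * (K + 1)) * (R - ε) + Real.exp 2 * (K * (K + 1)))

theorem gronwallFactor_pos (ε R K : ℝ) : 0 < gronwallFactor ε R K := Real.exp_pos _

/-- A bootstrap downwards from `R`: the hypothesis on `q` is available only at levels `ρ` where the
final bound already holds on `[ρ, R]`. Each strip multiplies the bound by at most `1 + D/λ ≤
e^{D/λ}`, and the number of strips is below `λ (R - ε) + 1`, so the bound never exceeds the allowed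
factor. -/
theorem integral_le_gronwallFactor {ε R K a lam : ℝ} (hεR : ε ≤ R) (hK : 0 ≤ K) (ha : 0 ≤ a)
    (hlam : 1 ≤ lam) (hKlam : K ≤ lam) {f q : ℝ → ℝ}
    (hf : IntervalIntegrable f volume ε R) (hq : IntervalIntegrable q volume ε R)
    (hf0 : ∀ r, 0 ≤ f r)
    (hfq : ∀ᵐ r ∂(volume.restrict (Ioo ε R)), f r ≤ K * (q r + a + ∫ t in r..R, f t))
    (hmin : ∀ ρ ∈ Icc ε R, a + (∫ r in ρ..R, f r) ≤ gronwallFactor ε R K * a →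
      ∫ r in ε..ρ, q r * Real.exp (2 * lam * r) ≤
        K * (a + ∫ r in ρ..R, f r) * ∫ r in ε..ρ, Real.exp (2 * lam * r)) :
    a + (∫ r in ε..R, f r) ≤ gronwallFactor ε R K * a := by
  have hlam0 : 0 < lam := by linarith
  set D := Real.exp 2 * (K * (K + 1)) with hD
  have hD0 : 0 ≤ D := by positivity
  -- The rounding up of the number of strips costs an extra `D/λ`, at most `D` because `1 ≤ λ`.
  have bound : ∀ m : ℕ, (m : ℝ) ≤ lam * (R - ε) + 1 →
      Real.exp (D * (m / lam)) ≤ gronwallFactor ε R K := by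
    intro m hm
    refine Real.exp_le_exp.2 ?_
    have h1 : (m : ℝ) / lam ≤ (R - ε) + 1 := by
      rw [div_le_iff₀ hlam0]
      nlinarith
    have := mul_le_mul_of_nonneg_left h1 hD0
    linarith
  have claim : ∀ m : ℕ, (m : ℝ) ≤ lam * (R - ε) + 1 → ∀ ρ ∈ Icc ε R, R - ρ ≤ m / lam →
      a + (∫ r in ρ..R, f r) ≤ Real.exp (D * (m / lam)) * a := by
    intro m
    induction m with
    | zero =>
      intro _ ρ hρ hm
      have : ρ = R := le_antisymm hρ.2 (by simpa using hm)
      simp [this]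
    | succ m ih =>
      intro hm ρ' hρ' hm'
      push_cast at hm hm'
      -- The upper end of the strip is cut off at `R`, where the strip may be shorter than `1/λ`.
      set ρ := min R (ρ' + 1 / lam) with hρdef
      have h1 : 0 < 1 / lam := by positivity
      have hρρ' : ρ' ≤ ρ := le_min hρ'.2 (by linarith)
      have hρ : ρ ∈ Icc ε R := ⟨hρ'.1.trans hρρ', min_le_left _ _⟩
      have hstep : ρ - ρ' ≤ 1 / lam := by linarith [min_le_right R (ρ' + 1 / lam)]
      have hRm : R - ρ ≤ m / lam := by
        rcases le_total R (ρ' + 1 / lam) with h | h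
        · rw [hρdef, min_eq_left h, sub_self]; positivity
        · rw [hρdef, min_eq_right h]
          rw [add_div] at hm'
          linarith
      have hih := ih (by linarith) ρ hρ hRm
      have hst := integral_strip_le hK ha hlam hKlam hf hq hf0 hfq hρ'.1 hρρ' hρ.2 hstep
        (hmin ρ hρ (hih.trans (mul_le_mul_of_nonneg_right (bound m (by linarith)) ha)))
      have hsplit : ∫ r in ρ'..R, f r = (∫ r in ρ'..ρ, f r) + ∫ r in ρ..R, f r := by
        refine (intervalIntegral.integral_add_adjacent_intervals (hf.mono_set ?_)
          (hf.mono_set ?_)).symm <;> rw [uIcc_of_le hεR]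
        · exact uIcc_subset_Icc hρ' hρ
        · exact uIcc_subset_Icc hρ ⟨hεR, le_rfl⟩
      set E := a + ∫ r in ρ..R, f r
      have hE0 : 0 ≤ E :=
        add_nonneg ha (intervalIntegral.integral_nonneg hρ.2 fun r _ => hf0 r)
      calc a + ∫ r in ρ'..R, f r ≤ (D / lam + 1) * E := by rw [hsplit]; linarith
        _ ≤ Real.exp (D / lam) * E :=
          mul_le_mul_of_nonneg_right (Real.add_one_le_exp _) hE0
        _ ≤ Real.exp (D / lam) * (Real.exp (D * (m / lam)) * a) :=
          mul_le_mul_of_nonneg_left hih (Real.exp_pos _).le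
        _ = Real.exp (D * (((m + 1 : ℕ) : ℝ) / lam)) * a := by
          rw [← mul_assoc, ← Real.exp_add]
          push_cast
          ring_nf
  have hpos : 0 ≤ lam * (R - ε) := mul_nonneg hlam0.le (by linarith)
  have hceil := Nat.ceil_lt_add_one hpos
  have := claim ⌈lam * (R - ε)⌉₊ hceil.le ε ⟨le_rfl, hεR⟩ (by
    rw [le_div_iff₀ hlam0, mul_comm]; exact Nat.le_ceil _)
  exact this.trans (mul_le_mul_of_nonneg_right (bound _ hceil.le) ha)

/-! ### Pointwise magnitude of semi-discrete functions -/

variable {N n k : ℕ}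

/-- The sum of the squares of all components at all nodes. -/
def sumSq (V : SemiDiscrete N n k) (r : ℝ) : ℝ := ∑ i, ∑ j, ∑ s, V i j s r ^ 2

theorem sumSq_nonneg (V : SemiDiscrete N n k) (r : ℝ) : 0 ≤ sumSq V r := by
  unfold sumSq; positivity

theorem sq_le_sumSq (V : SemiDiscrete N n k) (i : Fin (n + 1)) (j : Fin (k + 1)) (s : Fin N)
    (r : ℝ) : V i j s r ^ 2 ≤ sumSq V r := by
  have h1 : V i j s r ^ 2 ≤ ∑ s, V i j s r ^ 2 :=
    Finset.single_le_sum (f := fun s => V i j s r ^ 2) (fun _ _ => sq_nonneg _)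
      (Finset.mem_univ s)
  have h2 : ∑ s, V i j s r ^ 2 ≤ ∑ j, ∑ s, V i j s r ^ 2 :=
    Finset.single_le_sum (f := fun j => ∑ s, V i j s r ^ 2)
      (fun _ _ => Finset.sum_nonneg fun _ _ => sq_nonneg _) (Finset.mem_univ j)
  have h3 : ∑ j, ∑ s, V i j s r ^ 2 ≤ sumSq V r :=
    Finset.single_le_sum (f := fun i => ∑ j, ∑ s, V i j s r ^ 2)
      (fun _ _ => Finset.sum_nonneg fun _ _ => Finset.sum_nonneg fun _ _ => sq_nonneg _)
      (Finset.mem_univ i)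
  exact h1.trans (h2.trans h3)

/-- The Euclidean length of the vector of all components at all nodes. -/
def magnitude (V : SemiDiscrete N n k) (r : ℝ) : ℝ := √(sumSq V r)

theorem magnitude_nonneg (V : SemiDiscrete N n k) (r : ℝ) : 0 ≤ magnitude V r :=
  Real.sqrt_nonneg _

theorem magnitude_sq (V : SemiDiscrete N n k) (r : ℝ) : magnitude V r ^ 2 = sumSq V r :=
  Real.sq_sqrt (sumSq_nonneg V r)

theorem abs_le_magnitude (V : SemiDiscrete N n k) (i : Fin (n + 1)) (j : Fin (k + 1)) (s : Fin N)
    (r : ℝ) : |V i j s r| ≤ magnitude V r :=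
  Real.abs_le_sqrt (sq_le_sumSq V i j s r)

theorem abs_div_two_mul_le {a b m h h₀ : ℝ} (hh₀ : 0 < h₀) (h₀h : h₀ ≤ h) (ha : |a| ≤ m)
    (hb : |b| ≤ m) : |(a - b) / (2 * h)| ≤ m / h₀ := by
  have hm : 0 ≤ m := (abs_nonneg _).trans ha
  have hh : 0 < h := hh₀.trans_le h₀h
  rw [abs_div, abs_of_pos (by positivity : 0 < 2 * h), div_le_div_iff₀ (by positivity) hh₀]
  have : |a - b| ≤ 2 * m := (abs_sub _ _).trans (by linarith)
  nlinarith [mul_le_mul_of_nonneg_left h₀h hm]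

theorem abs_dPhi_le {h₀ : ℝ} (hh₀ : 0 < h₀) (h : h₀ ≤ stepPhi n) (V : SemiDiscrete N n k)
    (i : Fin (n + 1)) (j : Fin (k + 1)) (s : Fin N) (r : ℝ) :
    |dPhi V i j s r| ≤ magnitude V r / h₀ :=
  abs_div_two_mul_le hh₀ h (abs_le_magnitude _ _ _ _ _) (abs_le_magnitude _ _ _ _ _)

theorem abs_dZ_le {h₀ B : ℝ} (hh₀ : 0 < h₀) (h : h₀ ≤ stepZ B k) (V : SemiDiscrete N n k)
    (i : Fin (n + 1)) (j : Fin (k + 1)) (s : Fin N) (r : ℝ) :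
    |dZ B V i j s r| ≤ magnitude V r / h₀ := by
  unfold dZ
  split_ifs
  · exact abs_div_two_mul_le hh₀ h (abs_le_magnitude _ _ _ _ _) (abs_le_magnitude _ _ _ _ _)
  · rw [abs_zero]
    exact div_nonneg (magnitude_nonneg _ _) hh₀.le

theorem dPhi_sub (V W : SemiDiscrete N n k) : dPhi (V - W) = dPhi V - dPhi W := by
  funext i j s r
  simp only [dPhi, Pi.sub_apply]
  ring

theorem dZ_sub (B : ℝ) (V W : SemiDiscrete N n k) : dZ B (V - W) = dZ B V - dZ B W := by
  funext i j s r
  simp only [dZ, Pi.sub_apply]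
  split_ifs <;> ring

theorem InH1h.sub {ε R : ℝ} {V W : SemiDiscrete N n k} (hV : InH1h ε R V) (hW : InH1h ε R W) :
    InH1h ε R (V - W) := fun i j s => (hV i j s).sub (hW i j s)

theorem InH1h.dPhi {ε R : ℝ} {V : SemiDiscrete N n k} (hV : InH1h ε R V) :
    InH1h ε R (dPhi V) := fun i j s => by
  have := ((hV (nextPhi i) j s).sub (hV (prevPhi i) j s)).const_mul (1 / (2 * stepPhi n))
  refine this.ae_eq (Filter.Eventually.of_forall fun r => ?_)
  simp only [TravelTime.dPhi, Pi.sub_apply]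
  ring

theorem InH1h.dZ {ε R : ℝ} (B : ℝ) {V : SemiDiscrete N n k} (hV : InH1h ε R V) :
    InH1h ε R (dZ B V) := fun i j s => by
  by_cases hj : IsInteriorZ j
  · have := ((hV i (j + 1) s).sub (hV i (j - 1) s)).const_mul (1 / (2 * stepZ B k))
    refine this.ae_eq (Filter.Eventually.of_forall fun r => ?_)
    simp only [TravelTime.dZ, if_pos hj, Pi.sub_apply]
    ring
  · have : TravelTime.dZ B V i j s = 0 := by
      funext r
      simp only [TravelTime.dZ, if_neg hj, Pi.zero_apply]
    rw [this]
    exact MemLp.zero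

theorem InH1h.integrable_sumSq {ε R : ℝ} {V : SemiDiscrete N n k} (hV : InH1h ε R V) :
    Integrable (sumSq V) (volume.restrict (Ioo ε R)) :=
  integrable_finsetSum _ fun i _ => integrable_finsetSum _ fun j _ =>
    integrable_finsetSum _ fun s _ => (hV i j s).integrable_sq

theorem intervalIntegrable_of_integrable_Ioo {ε R : ℝ} (hεR : ε ≤ R) {f : ℝ → ℝ}
    (hf : Integrable f (volume.restrict (Ioo ε R))) {x y : ℝ} (hx : x ∈ Icc ε R)
    (hy : y ∈ Icc ε R) : IntervalIntegrable f volume x y := by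
  refine ((intervalIntegrable_iff_integrableOn_Ioo_of_le hεR).2 hf).mono_set ?_
  rw [uIcc_of_le hεR]
  exact uIcc_subset_Icc hx hy

theorem ae_restrict_Ioc_of_ae {ε R : ℝ} {P : ℝ → Prop}
    (h : ∀ᵐ r ∂(volume.restrict (Ioo ε R)), P r) {x y : ℝ} (hx : ε ≤ x) (hy : y ≤ R) :
    ∀ᵐ r ∂(volume.restrict (Ioc x y)), P r := by
  rw [← restrict_Ioo_eq_restrict_Ioc]
  exact ae_restrict_of_ae_restrict_of_subset (Ioo_subset_Ioo hx hy) h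

theorem InH1h.normSqL2h_eq {ε R : ℝ} (hεR : ε ≤ R) {V : SemiDiscrete N n k}
    (hV : InH1h ε R V) : normSqL2h ε R V = ∫ r in ε..R, sumSq V r := by
  have h : ∀ i j s, IntervalIntegrable (fun r => V i j s r ^ 2) volume ε R := fun i j s =>
    intervalIntegrable_of_integrable_Ioo hεR (hV i j s).integrable_sq ⟨le_rfl, hεR⟩ ⟨hεR, le_rfl⟩
  have h2 : ∀ i j, IntervalIntegrable (fun r => ∑ s, V i j s r ^ 2) volume ε R := fun i j => by
    simpa only [Finset.sum_fn] using IntervalIntegrable.sum Finset.univ fun s _ => h i j s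
  have h3 : ∀ i, IntervalIntegrable (fun r => ∑ j, ∑ s, V i j s r ^ 2) volume ε R := fun i => by
    simpa only [Finset.sum_fn] using IntervalIntegrable.sum Finset.univ fun j _ => h2 i j
  simp only [normSqL2h, sumSq]
  rw [intervalIntegral.integral_finsetSum fun i _ => h3 i]
  refine Finset.sum_congr rfl fun i _ => ?_
  rw [intervalIntegral.integral_finsetSum fun j _ => h2 i j]
  refine Finset.sum_congr rfl fun j _ => ?_
  rw [intervalIntegral.integral_finsetSum fun s _ => h i j s]

theorem aestronglyMeasurable_magnitude {ε R : ℝ} {V : SemiDiscrete N n k} (hV : InH1h ε R V) :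
    AEStronglyMeasurable (magnitude V) (volume.restrict (Ioo ε R)) :=
  Real.continuous_sqrt.comp_aestronglyMeasurable hV.integrable_sumSq.aestronglyMeasurable

theorem memLp_magnitude {ε R : ℝ} {V : SemiDiscrete N n k} (hV : InH1h ε R V) :
    MemLp (magnitude V) 2 (volume.restrict (Ioo ε R)) := by
  rw [memLp_two_iff_integrable_sq (aestronglyMeasurable_magnitude hV)]
  simpa only [magnitude_sq] using hV.integrable_sumSq

/-- The Cauchy-Schwarz inequality for real functions. -/
theorem sq_integral_mul_le {α : Type*} [MeasurableSpace α] {μ : Measure α} {f g : α → ℝ}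
    (hf : MemLp f 2 μ) (hg : MemLp g 2 μ) :
    (∫ x, f x * g x ∂μ) ^ 2 ≤ (∫ x, f x ^ 2 ∂μ) * ∫ x, g x ^ 2 ∂μ := by
  have hfg : Integrable (fun x => f x * g x) μ := hf.integrable_mul hg
  have h : ∀ x : ℝ, 0 ≤ (∫ y, f y ^ 2 ∂μ) * (x * x) + (2 * ∫ y, f y * g y ∂μ) * x +
      ∫ y, g y ^ 2 ∂μ := by
    intro x
    have e : (∫ y, (x * f y + g y) ^ 2 ∂μ) = (∫ y, f y ^ 2 ∂μ) * (x * x) +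
        (2 * ∫ y, f y * g y ∂μ) * x + ∫ y, g y ^ 2 ∂μ := by
      have e1 : ∀ y, (x * f y + g y) ^ 2 =
          x * x * f y ^ 2 + 2 * x * (f y * g y) + g y ^ 2 := fun y => by ring
      simp only [e1]
      have i1 : Integrable (fun y => x * x * f y ^ 2) μ := hf.integrable_sq.const_mul _
      have i2 : Integrable (fun y => 2 * x * (f y * g y)) μ := hfg.const_mul _
      have i3 : Integrable (fun y => x * x * f y ^ 2 + 2 * x * (f y * g y)) μ := i1.add i2
      rw [integral_add i3 hg.integrable_sq, integral_add i1 i2, integral_const_mul,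
        integral_const_mul]
      ring
    rw [← e]
    exact integral_nonneg fun y => sq_nonneg _
  have := discrim_le_zero h
  rw [discrim] at this
  nlinarith

/-! ### The truncated series -/

theorem lowerBound_pos {ε : ℝ} (hε : 0 < ε) (B : ℝ) : 0 < lowerBound ε B := by
  unfold lowerBound; positivity

/-- `κ` bounds the first `N` basis functions and their derivatives on `[0, B]`. -/
def BoundsBasis (B : ℝ) (N : ℕ) (κ : ℝ) : Prop :=
  0 ≤ κ ∧ ∀ s : Fin N, ∀ z ∈ Icc 0 B, |Psi B s z| ≤ κ ∧ |deriv (Psi B s) z| ≤ κ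

theorem abs_sum_mul_Psi_le {B κ : ℝ} (hκ : BoundsBasis B N κ) {a : Fin N → ℝ} {b : ℝ}
    (ha : ∀ s, |a s| ≤ b) {z : ℝ} (hz : z ∈ Icc 0 B) :
    |∑ s, a s * Psi B s z| ≤ N * κ * b := by
  refine (Finset.abs_sum_le_sum_abs _ _).trans ?_
  refine (Finset.sum_le_card_nsmul _ _ (b * κ) fun s _ => ?_).trans (le_of_eq ?_)
  · rw [abs_mul]
    exact mul_le_mul (ha s) (hκ.2 s z hz).1 (abs_nonneg _) ((abs_nonneg _).trans (ha s))
  · simp; ring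

theorem series_sub {B : ℝ} (V W : SemiDiscrete N n k) (i : Fin (n + 1)) (j : Fin (k + 1))
    (z r : ℝ) : series B (V - W) i j z r = series B V i j z r - series B W i j z r := by
  simp only [series, Pi.sub_apply, sub_mul, Finset.sum_sub_distrib]

theorem abs_series_le {B κ : ℝ} (hκ : BoundsBasis B N κ) (V : SemiDiscrete N n k)
    (i : Fin (n + 1)) (j : Fin (k + 1)) {z : ℝ} (hz : z ∈ Icc 0 B) (r : ℝ) :
    |series B V i j z r| ≤ N * κ * magnitude V r :=
  abs_sum_mul_Psi_le hκ (fun s => abs_le_magnitude V i j s r) hz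

theorem continuous_series (B : ℝ) (V : SemiDiscrete N n k)
    (i : Fin (n + 1)) (j : Fin (k + 1)) (r : ℝ) : Continuous fun z => series B V i j z r :=
  continuous_finsetSum _ fun s _ => continuous_const.mul (continuous_Psi B s)

theorem aestronglyMeasurable_series {ε R : ℝ} (B : ℝ) {V : SemiDiscrete N n k}
    (hV : InH1h ε R V) (i : Fin (n + 1)) (j : Fin (k + 1)) (z : ℝ) :
    AEStronglyMeasurable (series B V i j z) (volume.restrict (Ioo ε R)) :=
  Finset.aestronglyMeasurable_fun_sum _ fun s _ =>
    (hV i j s).aestronglyMeasurable.mul aestronglyMeasurable_const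

/-- The difference is split as `(x - x') / √y` plus `x'` times a difference of inverse square roots;
rationalizing the latter leaves a denominator of size at least `c * √c`. -/
theorem abs_div_sqrt_sub_le {c x x' y y' : ℝ} (hc : 0 < c) (hy : c ≤ y) (hy' : c ≤ y') :
    |x / √y - x' / √y'| ≤ |x - x'| / √c + |x'| * |y - y'| / (c * √c) := by
  have hsc := Real.sqrt_pos.2 hc
  have hsy := Real.sqrt_le_sqrt hy
  have hsy' := Real.sqrt_le_sqrt hy'
  have hpy := hsc.trans_le hsy
  have hpy' := hsc.trans_le hsy'
  have e : x / √y - x' / √y' = (x - x') / √y + x' * (y' - y) / ((√y * √y') * (√y + √y')) := by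
    have h1 := Real.sq_sqrt (hc.le.trans hy)
    have h2 := Real.sq_sqrt (hc.le.trans hy')
    have h3 : y' - y = (√y' - √y) * (√y + √y') := by nlinarith
    rw [h3]
    field_simp
    ring
  rw [e]
  refine (abs_add_le _ _).trans (add_le_add ?_ ?_)
  · rw [abs_div, abs_of_pos hpy]
    gcongr
  · rw [abs_div, abs_mul, abs_sub_comm y' y, abs_of_pos (by positivity : 0 < √y * √y' * (√y + √y'))]
    have hcc : c * √c ≤ √y * √y' * (√y + √y') := by
      have h1 : c ≤ √y * √y' := by
        calc c = √c * √c := (Real.mul_self_sqrt hc.le).symm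
          _ ≤ √y * √y' := by gcongr
      have h2 : √c ≤ √y + √y' := by linarith
      gcongr
    gcongr

theorem abs_div_sqrt_le {c x y : ℝ} (hc : 0 < c) (hy : c ≤ y) : |x / √y| ≤ |x| / √c := by
  have hsc := Real.sqrt_pos.2 hc
  have hsy := Real.sqrt_le_sqrt hy
  rw [abs_div, abs_of_pos (hsc.trans_le hsy)]
  gcongr

/-- Functions in `H_N^{1,h}` with `u ≥ c` whose squared `L₂` norm is at most `K`. -/
structure IsRegular (ε R B K : ℝ) (V : SemiDiscrete N n k) : Prop where
  memH : InH1h ε R V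
  lower : ∀ i j, ∀ᵐ r ∂(volume.restrict (Ioo ε R)), ∀ z₀ ∈ Icc 0 B,
    lowerBound ε B ≤ series B V i j z₀ r
  bound : ∫ r in ε..R, sumSq V r ≤ K

theorem IsRegular.integral_tail_le {ε R B K : ℝ} (hεR : ε ≤ R) {V : SemiDiscrete N n k}
    (hV : IsRegular ε R B K V) {r : ℝ} (hr : r ∈ Icc ε R) : ∫ t in r..R, sumSq V t ≤ K := by
  refine le_trans ?_ hV.bound
  have hi := hV.memH.integrable_sumSq
  rw [← intervalIntegral.integral_add_adjacent_intervals
    (intervalIntegrable_of_integrable_Ioo hεR hi ⟨le_rfl, hεR⟩ hr)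
    (intervalIntegrable_of_integrable_Ioo hεR hi hr ⟨hεR, le_rfl⟩)]
  have := intervalIntegral.integral_nonneg hr.1 (fun t _ => sumSq_nonneg V t) (μ := volume)
  linarith

/-! ### Estimates of the bracket -/

theorem sq_integral_mul_le_interval {r R : ℝ} (hrR : r ≤ R) {f g : ℝ → ℝ}
    (hf : MemLp f 2 (volume.restrict (Ioo r R))) (hg : MemLp g 2 (volume.restrict (Ioo r R))) :
    (∫ t in r..R, f t * g t) ^ 2 ≤ (∫ t in r..R, f t ^ 2) * ∫ t in r..R, g t ^ 2 := by
  simp only [intervalIntegral.integral_of_le hrR, integral_Ioc_eq_integral_Ioo]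
  exact sq_integral_mul_le hf hg

/-- The derivative term `D` of the bracket at the node `(i, j)`, for a function `V`. -/
structure IsControlled (ε R h₀ : ℝ) (V D : SemiDiscrete N n k) (i : Fin (n + 1))
    (j : Fin (k + 1)) : Prop where
  memH : InH1h ε R D
  le : ∀ s r, |D i j s r| ≤ magnitude V r / h₀

section Bracket

variable {ε R B K h₀ κ Λ : ℝ} {V V' D D' : SemiDiscrete N n k} {i : Fin (n + 1)}
  {j : Fin (k + 1)} {dp : Fin N → ℝ}

theorem integrable_magnitude (hV : InH1h ε R V) :
    Integrable (magnitude V) (volume.restrict (Ioo ε R)) :=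
  (memLp_magnitude hV).integrable (by norm_num)

theorem abs_quotient_le (hε : 0 < ε) (hκ : BoundsBasis B N κ)
    (hD : IsControlled ε R h₀ V D i j) {z r : ℝ} (hz : z ∈ Icc 0 B)
    (h : lowerBound ε B ≤ series B V i j z r) :
    |series B D i j z r / √(series B V i j z r)| ≤
      N * κ / (h₀ * √(lowerBound ε B)) * magnitude V r := by
  have hc := Real.sqrt_pos.2 (lowerBound_pos hε B)
  refine (abs_div_sqrt_le (lowerBound_pos hε B) h).trans ?_
  have : |series B D i j z r| ≤ N * κ * (magnitude V r / h₀) :=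
    abs_sum_mul_Psi_le hκ (fun s => hD.le s r) hz
  calc _ ≤ N * κ * (magnitude V r / h₀) / √(lowerBound ε B) := by gcongr
    _ = _ := by rw [div_mul_eq_mul_div, mul_div_assoc', div_div]

theorem aestronglyMeasurable_quotient (hV : InH1h ε R V) (hD : InH1h ε R D) (z : ℝ) :
    AEStronglyMeasurable (fun t => series B D i j z t / √(series B V i j z t))
      (volume.restrict (Ioo ε R)) :=
  ((aestronglyMeasurable_series B hD i j z).aemeasurable.div
    (Real.continuous_sqrt.comp_aestronglyMeasurable
      (aestronglyMeasurable_series B hV i j z)).aemeasurable).aestronglyMeasurable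

theorem integrable_quotient (hε : 0 < ε) (hκ : BoundsBasis B N κ) (hV : IsRegular ε R B K V)
    (hD : IsControlled ε R h₀ V D i j) {z : ℝ} (hz : z ∈ Icc 0 B) :
    Integrable (fun t => series B D i j z t / √(series B V i j z t))
      (volume.restrict (Ioo ε R)) := by
  refine ((integrable_magnitude hV.memH).const_mul (N * κ / (h₀ * √(lowerBound ε B)))).mono'
    (aestronglyMeasurable_quotient hV.memH hD.memH z) ?_
  filter_upwards [hV.lower i j] with t ht
  exact abs_quotient_le hε hκ hD hz (ht z hz)

/-- The modulus of continuity of the bracket in `r`. -/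
theorem abs_bracket_sub_bracket_le (hε : 0 < ε) (hεR : ε ≤ R) (hκ : BoundsBasis B N κ)
    (hV : IsRegular ε R B K V) (hD : IsControlled ε R h₀ V D i j) {z : ℝ} (hz : z ∈ Icc 0 B)
    {r r' : ℝ} (hr : r ∈ Icc ε R) (hr' : r' ∈ Icc ε R) (hrr' : r ≤ r') :
    |bracket R B V D dp i j r z - bracket R B V D dp i j r' z| ≤
      N * κ / (h₀ * √(lowerBound ε B)) * ∫ t in r..r', magnitude V t := by
  have hi := integrable_quotient hε hκ hV hD hz
  have hRR : R ∈ Icc ε R := ⟨hεR, le_rfl⟩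
  have e : bracket R B V D dp i j r z - bracket R B V D dp i j r' z =
      -(1 / 2) * ∫ t in r..r', series B D i j z t / √(series B V i j z t) := by
    rw [bracket, bracket, ← intervalIntegral.integral_add_adjacent_intervals
      (intervalIntegrable_of_integrable_Ioo hεR hi hr hr')
      (intervalIntegrable_of_integrable_Ioo hεR hi hr' hRR)]
    ring
  have hb : |∫ t in r..r', series B D i j z t / √(series B V i j z t)| ≤
      ∫ t in r..r', N * κ / (h₀ * √(lowerBound ε B)) * magnitude V t := by
    rw [← Real.norm_eq_abs]
    refine intervalIntegral.norm_integral_le_of_norm_le hrr' ?_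
      ((intervalIntegrable_of_integrable_Ioo hεR (integrable_magnitude hV.memH) hr hr').const_mul _)
    refine (ae_restrict_iff' measurableSet_Ioc).1 ?_
    filter_upwards [ae_restrict_Ioc_of_ae (hV.lower i j) hr.1 hr'.2] with t ht
    exact abs_quotient_le hε hκ hD hz (ht z hz)
  rw [intervalIntegral.integral_const_mul] at hb
  rw [e, abs_mul]
  have : |(-(1 / 2) : ℝ)| = 1 / 2 := by norm_num
  rw [this]
  linarith [abs_nonneg (∫ t in r..r', series B D i j z t / √(series B V i j z t))]

theorem integral_magnitude_le (hεR : ε ≤ R) (hV : IsRegular ε R B K V) {r : ℝ}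
    (hr : r ∈ Icc ε R) : ∫ t in r..R, magnitude V t ≤ (R - ε) + K := by
  have hRR : R ∈ Icc ε R := ⟨hεR, le_rfl⟩
  have h1 := intervalIntegrable_of_integrable_Ioo hεR hV.memH.integrable_sumSq hr hRR
  calc ∫ t in r..R, magnitude V t ≤ ∫ t in r..R, (1 + sumSq V t) := by
        refine intervalIntegral.integral_mono_on hr.2
          (intervalIntegrable_of_integrable_Ioo hεR (integrable_magnitude hV.memH) hr hRR)
          (intervalIntegrable_const.add h1) fun t _ => ?_
        rw [← magnitude_sq]
        nlinarith [sq_nonneg (magnitude V t - 1), magnitude_nonneg V t]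
    _ = (R - r) + ∫ t in r..R, sumSq V t := by
        rw [intervalIntegral.integral_add intervalIntegrable_const h1]
        simp
    _ ≤ (R - ε) + K := by linarith [hV.integral_tail_le hεR hr, hr.1]

/-- The bound of the bracket. -/
def bracketBound (ε R B K h₀ κ Λ : ℝ) (N : ℕ) : ℝ :=
  N * κ / (h₀ * √(lowerBound ε B)) * ((R - ε) + K) + N * κ * |Λ|

theorem bracketBound_nonneg (hεR : ε ≤ R) (hK : 0 ≤ K) (hh₀ : 0 < h₀)
    (hκ : BoundsBasis B N κ) : 0 ≤ bracketBound ε R B K h₀ κ Λ N := by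
  have := hκ.1
  have : 0 ≤ R - ε := by linarith
  unfold bracketBound
  positivity

theorem abs_bracket_le (hε : 0 < ε) (hεR : ε ≤ R) (hh₀ : 0 < h₀) (hκ : BoundsBasis B N κ)
    (hV : IsRegular ε R B K V) (hD : IsControlled ε R h₀ V D i j) (hdp : ∀ s, |dp s| ≤ |Λ|)
    {z : ℝ} (hz : z ∈ Icc 0 B) {r : ℝ} (hr : r ∈ Icc ε R) :
    |bracket R B V D dp i j r z| ≤ bracketBound ε R B K h₀ κ Λ N := by
  have h1 := abs_bracket_sub_bracket_le (dp := dp) hε hεR hκ hV hD hz hr ⟨hεR, le_rfl⟩ hr.2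
  have h2 : bracket R B V D dp i j R z = ∑ s, dp s * Psi B s z := by simp [bracket]
  have h3 := abs_sum_mul_Psi_le hκ hdp hz
  have h4 := integral_magnitude_le hεR hV hr
  have hκ0 := hκ.1
  have h5 : N * κ / (h₀ * √(lowerBound ε B)) * (∫ t in r..R, magnitude V t) ≤
      N * κ / (h₀ * √(lowerBound ε B)) * ((R - ε) + K) :=
    mul_le_mul_of_nonneg_left h4 (by positivity)
  have h6 := abs_sub_abs_le_abs_sub (bracket R B V D dp i j r z) (bracket R B V D dp i j R z)
  rw [h2] at h1 h6
  unfold bracketBound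
  linarith

/-- Dominated convergence, with a multiple of the integrable `magnitude V` as majorant. Continuity
in `z₀` makes the integral in `projDerivSq` additive, which the difference estimate needs. -/
theorem continuousOn_bracket (hε : 0 < ε) (hκ : BoundsBasis B N κ)
    (hV : IsRegular ε R B K V) (hD : IsControlled ε R h₀ V D i j) {r : ℝ} (hr : r ∈ Icc ε R) :
    ContinuousOn (fun z => bracket R B V D dp i j r z) (Icc 0 B) := by
  have hμ : volume.restrict (Ioc r R) ≤ volume.restrict (Ioo ε R) := by
    rw [← restrict_Ioo_eq_restrict_Ioc]
    exact Measure.restrict_mono (Ioo_subset_Ioo_left hr.1) le_rfl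
  refine ContinuousOn.add (continuousOn_const.mul ?_) (Continuous.continuousOn
    (continuous_finsetSum _ fun s _ => continuous_const.mul (continuous_Psi B s)))
  simp only [intervalIntegral.integral_of_le hr.2]
  refine continuousOn_of_dominated
    (bound := fun t => N * κ / (h₀ * √(lowerBound ε B)) * magnitude V t)
    (fun z _ => (aestronglyMeasurable_quotient hV.memH hD.memH z).mono_measure hμ)
    (fun z hz => ?_) (((integrable_magnitude hV.memH).const_mul _).mono_measure hμ) ?_
  · filter_upwards [ae_restrict_Ioc_of_ae (hV.lower i j) hr.1 le_rfl] with t ht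
    exact abs_quotient_le hε hκ hD hz (ht z hz)
  · filter_upwards [ae_restrict_Ioc_of_ae (hV.lower i j) hr.1 le_rfl] with t ht
    refine (continuous_series B D i j t).continuousOn.div
      (Real.continuous_sqrt.comp (continuous_series B V i j t)).continuousOn fun z hz => ?_
    exact (Real.sqrt_pos.2 ((lowerBound_pos hε B).trans_le (ht z hz))).ne'

/-- The Lipschitz constant of the quotient `u_x / √u`. -/
def quotientLip (ε B h₀ κ : ℝ) (N : ℕ) : ℝ :=
  N * κ / h₀ / √(lowerBound ε B) + N * κ / h₀ * (N * κ) / (lowerBound ε B * √(lowerBound ε B))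

theorem quotientLip_nonneg (hε : 0 < ε) (hh₀ : 0 < h₀) (hκ : BoundsBasis B N κ) :
    0 ≤ quotientLip ε B h₀ κ N := by
  have := hκ.1
  have := lowerBound_pos hε B
  unfold quotientLip
  positivity

/-- The quotient is only locally Lipschitz: since `D'` has no pointwise bound, the factor `1 +
magnitude V'` remains. It lies in `L₂`, which suffices after integration. -/
theorem abs_quotient_sub_le (hε : 0 < ε) (hh₀ : 0 < h₀) (hκ : BoundsBasis B N κ)
    (hD' : IsControlled ε R h₀ V' D' i j)
    (hDD' : ∀ s r, |D i j s r - D' i j s r| ≤ magnitude (V - V') r / h₀)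
    {z r : ℝ} (hz : z ∈ Icc 0 B) (h : lowerBound ε B ≤ series B V i j z r)
    (h' : lowerBound ε B ≤ series B V' i j z r) :
    |series B D i j z r / √(series B V i j z r) - series B D' i j z r / √(series B V' i j z r)| ≤
      quotientLip ε B h₀ κ N * ((1 + magnitude V' r) * magnitude (V - V') r) := by
  have hcp := lowerBound_pos hε B
  set c := lowerBound ε B with hc
  have hsc := Real.sqrt_pos.2 hcp
  have hκ0 := hκ.1
  have hm := magnitude_nonneg V' r
  have hm' := magnitude_nonneg (V - V') r
  have h1 : |series B D i j z r - series B D' i j z r| ≤ N * κ * (magnitude (V - V') r / h₀) := by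
    rw [← series_sub]
    exact abs_sum_mul_Psi_le hκ (fun s => hDD' s r) hz
  have h2 : |series B D' i j z r| ≤ N * κ * (magnitude V' r / h₀) :=
    abs_sum_mul_Psi_le hκ (fun s => hD'.le s r) hz
  have h3 : |series B V i j z r - series B V' i j z r| ≤ N * κ * magnitude (V - V') r := by
    rw [← series_sub]
    exact abs_series_le hκ _ i j hz r
  refine (abs_div_sqrt_sub_le hcp h h').trans ?_
  calc _ ≤ N * κ * (magnitude (V - V') r / h₀) / √c +
        N * κ * (magnitude V' r / h₀) * (N * κ * magnitude (V - V') r) / (c * √c) := by gcongr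
    _ = N * κ / h₀ / √c * (1 * magnitude (V - V') r) +
        N * κ / h₀ * (N * κ) / (c * √c) * (magnitude V' r * magnitude (V - V') r) := by ring
    _ ≤ N * κ / h₀ / √c * ((1 + magnitude V' r) * magnitude (V - V') r) +
        N * κ / h₀ * (N * κ) / (c * √c) * ((1 + magnitude V' r) * magnitude (V - V') r) := by
      gcongr <;> linarith
    _ = _ := by rw [quotientLip]; ring

/-- The Volterra estimate of the difference of two brackets. -/
theorem abs_bracket_sub_le (hε : 0 < ε) (hεR : ε ≤ R) (hh₀ : 0 < h₀) (hκ : BoundsBasis B N κ)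
    (hV : IsRegular ε R B K V) (hV' : IsRegular ε R B K V')
    (hD : IsControlled ε R h₀ V D i j) (hD' : IsControlled ε R h₀ V' D' i j)
    (hDD' : ∀ s r, |D i j s r - D' i j s r| ≤ magnitude (V - V') r / h₀)
    {z : ℝ} (hz : z ∈ Icc 0 B) {r : ℝ} (hr : r ∈ Icc ε R) :
    |bracket R B V D dp i j r z - bracket R B V' D' dp i j r z| ≤
      quotientLip ε B h₀ κ N * √(2 * (R - ε) + 2 * K) * √(∫ t in r..R, sumSq (V - V') t) := by
  have hRR : R ∈ Icc ε R := ⟨hεR, le_rfl⟩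
  have hi := intervalIntegrable_of_integrable_Ioo hεR (integrable_quotient hε hκ hV hD hz) hr hRR
  have hi' :=
    intervalIntegrable_of_integrable_Ioo hεR (integrable_quotient hε hκ hV' hD' hz) hr hRR
  have hL := quotientLip_nonneg hε hh₀ hκ
  have hd := hV.memH.sub hV'.memH
  set L := quotientLip ε B h₀ κ N
  have m1 : MemLp (fun t => 1 + magnitude V' t) 2 (volume.restrict (Ioo ε R)) :=
    MemLp.add (f := fun _ => (1 : ℝ)) (memLp_const (1 : ℝ)) (memLp_magnitude hV'.memH)
  have m2 := memLp_magnitude hd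
  have hint : IntervalIntegrable (fun t => (1 + magnitude V' t) * magnitude (V - V') t)
      volume r R := intervalIntegrable_of_integrable_Ioo hεR (m1.integrable_mul m2) hr hRR
  have hle : Measure.restrict volume (Ioo r R) ≤ volume.restrict (Ioo ε R) :=
    Measure.restrict_mono (Ioo_subset_Ioo_left hr.1) le_rfl
  -- Cauchy–Schwarz separates the factor `1 + magnitude V'`, whose `L₂` norm is controlled by `K`,
  -- from the error, which contributes the root of its energy on `[r, R]`.
  have hCS := sq_integral_mul_le_interval hr.2 (m1.mono_measure hle) (m2.mono_measure hle)
  simp only [magnitude_sq] at hCS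
  have hsq : ∫ t in r..R, (1 + magnitude V' t) ^ 2 ≤ 2 * (R - ε) + 2 * K := by
    have i1 := intervalIntegrable_of_integrable_Ioo hεR hV'.memH.integrable_sumSq hr hRR
    calc ∫ t in r..R, (1 + magnitude V' t) ^ 2 ≤ ∫ t in r..R, (2 + 2 * sumSq V' t) := by
          refine intervalIntegral.integral_mono_on hr.2
            (intervalIntegrable_of_integrable_Ioo hεR m1.integrable_sq hr hRR)
            (intervalIntegrable_const.add (i1.const_mul 2)) fun t _ => ?_
          rw [← magnitude_sq]
          nlinarith [sq_nonneg (magnitude V' t - 1)]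
      _ = (R - r) * 2 + 2 * ∫ t in r..R, sumSq V' t := by
          rw [intervalIntegral.integral_add intervalIntegrable_const (i1.const_mul 2),
            intervalIntegral.integral_const_mul]
          simp
      _ ≤ _ := by linarith [hV'.integral_tail_le hεR hr, hr.1]
  have hE : 0 ≤ ∫ t in r..R, sumSq (V - V') t :=
    intervalIntegral.integral_nonneg hr.2 fun t _ => sumSq_nonneg _ t
  have hI : ∫ t in r..R, (1 + magnitude V' t) * magnitude (V - V') t ≤
      √(2 * (R - ε) + 2 * K) * √(∫ t in r..R, sumSq (V - V') t) := by
    rw [← Real.sqrt_mul' _ hE]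
    refine Real.le_sqrt_of_sq_le (hCS.trans ?_)
    gcongr
  set q : ℝ → ℝ := fun t => series B D i j z t / √(series B V i j z t) -
    series B D' i j z t / √(series B V' i j z t) with hq
  have e : bracket R B V D dp i j r z - bracket R B V' D' dp i j r z =
      -(1 / 2) * ∫ t in r..R, q t := by
    rw [hq, intervalIntegral.integral_sub hi hi', bracket, bracket]
    ring
  have hb : |∫ t in r..R, q t| ≤
      ∫ t in r..R, L * ((1 + magnitude V' t) * magnitude (V - V') t) := by
    rw [← Real.norm_eq_abs]
    refine intervalIntegral.norm_integral_le_of_norm_le hr.2 ?_ (hint.const_mul _)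
    refine (ae_restrict_iff' measurableSet_Ioc).1 ?_
    filter_upwards [ae_restrict_Ioc_of_ae (hV.lower i j) hr.1 le_rfl,
      ae_restrict_Ioc_of_ae (hV'.lower i j) hr.1 le_rfl] with t ht ht'
    exact abs_quotient_sub_le hε hh₀ hκ hD' hDD' hz (ht z hz) (ht' z hz)
  rw [intervalIntegral.integral_const_mul] at hb
  have hb2 := hb.trans (mul_le_mul_of_nonneg_left hI hL)
  have h12 : |(-(1 / 2) : ℝ)| = 1 / 2 := by norm_num
  rw [e, abs_mul, h12, mul_assoc]
  exact (mul_le_of_le_one_left (abs_nonneg _) (by norm_num)).trans hb2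

end Bracket

/-! ### The projected derivative of a square -/

/-- Rests on `f² - g² = (f + g)(f - g)`. In the constant, `2` comes from the two endpoint terms and
`B` from the length of the interval of integration. -/
theorem abs_projDerivSq_sub_le {B κ b d : ℝ} (hB : 0 ≤ B) (hκ : BoundsBasis B N κ)
    {f g : ℝ → ℝ} (hf : ContinuousOn f (Icc 0 B)) (hg : ContinuousOn g (Icc 0 B))
    (hfb : ∀ z ∈ Icc 0 B, |f z| ≤ b) (hgb : ∀ z ∈ Icc 0 B, |g z| ≤ b)
    (hfg : ∀ z ∈ Icc 0 B, |f z - g z| ≤ d) (m : Fin N) :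
    |projDerivSq B m f - projDerivSq B m g| ≤ (2 + B) * κ * (2 * b) * d := by
  have h0 : (0 : ℝ) ∈ Icc 0 B := ⟨le_rfl, hB⟩
  have hBB : B ∈ Icc 0 B := ⟨hB, le_rfl⟩
  have hκ0 := hκ.1
  have hb0 : 0 ≤ b := (abs_nonneg _).trans (hfb 0 h0)
  have hd0 : 0 ≤ d := (abs_nonneg _).trans (hfg 0 h0)
  have hsq : ∀ z ∈ Icc 0 B, |f z ^ 2 - g z ^ 2| ≤ 2 * b * d := by
    intro z hz
    rw [sq_sub_sq, abs_mul]
    have : |f z + g z| ≤ 2 * b := (abs_add_le _ _).trans (by linarith [hfb z hz, hgb z hz])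
    exact mul_le_mul this (hfg z hz) (abs_nonneg _) (by positivity)
  have hI : ∀ {h : ℝ → ℝ}, ContinuousOn h (Icc 0 B) →
      IntervalIntegrable (fun z => deriv (Psi B m) z * h z ^ 2) volume 0 B := by
    intro h hh
    refine ContinuousOn.intervalIntegrable ?_
    rw [uIcc_of_le hB]
    exact (continuous_deriv_Psi B m).continuousOn.mul (hh.pow 2)
  have hint : |∫ z in (0 : ℝ)..B, deriv (Psi B m) z * (f z ^ 2 - g z ^ 2)| ≤
      κ * (2 * b * d) * |B - 0| := by
    rw [← Real.norm_eq_abs]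
    refine intervalIntegral.norm_integral_le_of_norm_le_const fun z hz => ?_
    rw [uIoc_of_le hB] at hz
    have hz' := Ioc_subset_Icc_self hz
    rw [Real.norm_eq_abs, abs_mul]
    exact mul_le_mul (hκ.2 m z hz').2 (hsq z hz') (abs_nonneg _) hκ0
  rw [sub_zero, abs_of_nonneg hB] at hint
  have e : projDerivSq B m f - projDerivSq B m g =
      Psi B m B * (f B ^ 2 - g B ^ 2) - Psi B m 0 * (f 0 ^ 2 - g 0 ^ 2) -
        ∫ z in (0 : ℝ)..B, deriv (Psi B m) z * (f z ^ 2 - g z ^ 2) := by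
    simp only [mul_sub]
    rw [intervalIntegral.integral_sub (hI hf) (hI hg), projDerivSq, projDerivSq]
    ring
  have h1 : |Psi B m B * (f B ^ 2 - g B ^ 2)| ≤ κ * (2 * b * d) := by
    rw [abs_mul]
    exact mul_le_mul (hκ.2 m B hBB).1 (hsq B hBB) (abs_nonneg _) hκ0
  have h2 : |Psi B m 0 * (f 0 ^ 2 - g 0 ^ 2)| ≤ κ * (2 * b * d) := by
    rw [abs_mul]
    exact mul_le_mul (hκ.2 m 0 h0).1 (hsq 0 h0) (abs_nonneg _) hκ0
  rw [e]
  refine (abs_sub _ _).trans ?_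
  have := abs_sub (Psi B m B * (f B ^ 2 - g B ^ 2)) (Psi B m 0 * (f 0 ^ 2 - g 0 ^ 2))
  nlinarith

theorem ContinuousOn.of_abs_sub_le {h G : ℝ → ℝ} {s : Set ℝ} {C : ℝ} (hC : 0 ≤ C)
    (hG : ContinuousOn G s)
    (hle : ∀ r ∈ s, ∀ r' ∈ s, r ≤ r' → |h r - h r'| ≤ C * |G r - G r'|) :
    ContinuousOn h s := by
  rw [Metric.continuousOn_iff] at hG ⊢
  intro r hr η hη
  -- Dividing by `C + 1` covers the case `C = 0`.
  obtain ⟨δ, hδ, H⟩ := hG r hr (η / (C + 1)) (by positivity)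
  refine ⟨δ, hδ, fun r' hr' hd => ?_⟩
  have h1 := H r' hr' hd
  rw [Real.dist_eq, lt_div_iff₀ (by positivity)] at h1
  have h2 : |h r' - h r| ≤ C * |G r' - G r| := by
    rcases le_total r' r with h' | h'
    · exact hle r' hr' r hr h'
    · rw [abs_sub_comm, abs_sub_comm (G r')]
      exact hle r hr r' hr' h'
  rw [Real.dist_eq]
  nlinarith [abs_nonneg (G r' - G r)]

/-! ### The nonlinear term -/

section Projection

variable {ε R B K h₀ κ Λ : ℝ} {V V' D D' : SemiDiscrete N n k} {i : Fin (n + 1)}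
  {j : Fin (k + 1)} {dp : Fin N → ℝ}

theorem abs_projDerivSq_bracket_sub_le (hε : 0 < ε) (hεR : ε ≤ R) (hB : 0 ≤ B) (hh₀ : 0 < h₀)
    (hκ : BoundsBasis B N κ) (hV : IsRegular ε R B K V) (hV' : IsRegular ε R B K V')
    (hD : IsControlled ε R h₀ V D i j) (hD' : IsControlled ε R h₀ V' D' i j)
    (hDD' : ∀ s r, |D i j s r - D' i j s r| ≤ magnitude (V - V') r / h₀)
    (hdp : ∀ s, |dp s| ≤ |Λ|) {r : ℝ} (hr : r ∈ Icc ε R) (m : Fin N) :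
    |projDerivSq B m (bracket R B V D dp i j r) - projDerivSq B m (bracket R B V' D' dp i j r)| ≤
      (2 + B) * κ * (2 * bracketBound ε R B K h₀ κ Λ N) *
        (quotientLip ε B h₀ κ N * √(2 * (R - ε) + 2 * K) * √(∫ t in r..R, sumSq (V - V') t)) :=
  abs_projDerivSq_sub_le hB hκ (continuousOn_bracket hε hκ hV hD hr)
    (continuousOn_bracket hε hκ hV' hD' hr)
    (fun _ hz => abs_bracket_le hε hεR hh₀ hκ hV hD hdp hz hr)
    (fun _ hz => abs_bracket_le hε hεR hh₀ hκ hV' hD' hdp hz hr)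
    (fun _ hz => abs_bracket_sub_le hε hεR hh₀ hκ hV hV' hD hD' hDD' hz hr) m

/-- Increments in `r` are dominated by those of the primitive of `magnitude V`. This yields the
measurability and boundedness that put the residual in `L₂`. -/
theorem continuousOn_projDerivSq_bracket (hε : 0 < ε) (hεR : ε ≤ R) (hB : 0 ≤ B) (hh₀ : 0 < h₀)
    (hκ : BoundsBasis B N κ) (hK : 0 ≤ K) (hV : IsRegular ε R B K V)
    (hD : IsControlled ε R h₀ V D i j) (hdp : ∀ s, |dp s| ≤ |Λ|) (m : Fin N) :
    ContinuousOn (fun r => projDerivSq B m (bracket R B V D dp i j r)) (Icc ε R) := by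
  have hi := integrable_magnitude hV.memH
  have hb := bracketBound_nonneg (Λ := Λ) hεR hK hh₀ hκ
  have hκ0 := hκ.1
  have hG : ContinuousOn (fun r => ∫ t in ε..r, magnitude V t) (Icc ε R) := by
    have := intervalIntegral.continuousOn_primitive_interval' (b₁ := ε) (b₂ := R) (a := ε)
      (intervalIntegrable_of_integrable_Ioo hεR hi ⟨le_rfl, hεR⟩ ⟨hεR, le_rfl⟩) (by simp)
    rwa [uIcc_of_le hεR] at this
  refine ContinuousOn.of_abs_sub_le
    (C := (2 + B) * κ * (2 * bracketBound ε R B K h₀ κ Λ N) *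
      (N * κ / (h₀ * √(lowerBound ε B)))) (by positivity) hG fun r hr r' hr' hrr' => ?_
  have e : (∫ t in ε..r', magnitude V t) - ∫ t in ε..r, magnitude V t =
      ∫ t in r..r', magnitude V t := by
    rw [← intervalIntegral.integral_add_adjacent_intervals
      (intervalIntegrable_of_integrable_Ioo hεR hi ⟨le_rfl, hεR⟩ hr)
      (intervalIntegrable_of_integrable_Ioo hεR hi hr hr')]
    ring
  rw [abs_sub_comm (∫ t in ε..r, magnitude V t), e, abs_of_nonneg
    (intervalIntegral.integral_nonneg hrr' fun t _ => magnitude_nonneg V t), mul_assoc]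
  exact abs_projDerivSq_sub_le hB hκ (continuousOn_bracket hε hκ hV hD hr)
    (continuousOn_bracket hε hκ hV hD hr')
    (fun _ hz => abs_bracket_le hε hεR hh₀ hκ hV hD hdp hz hr)
    (fun _ hz => abs_bracket_le hε hεR hh₀ hκ hV hD hdp hz hr')
    (fun _ hz => abs_bracket_sub_bracket_le hε hεR hκ hV hD hz hr hr' hrr') m

end Projection

/-- The parameters of the problem, apart from the data. -/
structure Setting (ε R B h₀ κ : ℝ) (N n k : ℕ) : Prop where
  hε : 0 < ε
  hεR : ε < R
  hB : 0 < B
  hh₀ : 0 < h₀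
  hκ : BoundsBasis B N κ
  hn : 1 ≤ n
  hk : 1 ≤ k
  hφ : h₀ ≤ stepPhi n
  hz : h₀ ≤ stepZ B k

section Nonlinear

variable {ε R B K h₀ κ Λ : ℝ} {V V' : SemiDiscrete N n k} {p : Fin N → ℝ → ℝ → ℝ}

theorem Setting.controlled_dPhi (hS : Setting ε R B h₀ κ N n k) (hV : InH1h ε R V)
    (i : Fin (n + 1)) (j : Fin (k + 1)) : IsControlled ε R h₀ V (dPhi V) i j :=
  ⟨hV.dPhi, fun s r => abs_dPhi_le hS.hh₀ hS.hφ V i j s r⟩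

theorem Setting.controlled_dZ (hS : Setting ε R B h₀ κ N n k) (hV : InH1h ε R V)
    (i : Fin (n + 1)) (j : Fin (k + 1)) : IsControlled ε R h₀ V (dZ B V) i j :=
  ⟨hV.dZ B, fun s r => abs_dZ_le hS.hh₀ hS.hz V i j s r⟩

theorem IsTravelTimeData.abs_deriv_le (hB : 0 < B) (hk : 1 ≤ k)
    (hp : IsTravelTimeData B Λ p) {j : Fin (k + 1)} (hj : IsInteriorZ j) (φ : ℝ) (s : Fin N) :
    |deriv (fun φ' => p s φ' (j * stepZ B k)) φ| ≤ |Λ| ∧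
      |deriv (fun z => p s φ z) (j * stepZ B k)| ≤ |Λ| := by
  have hk0 : (0 : ℝ) < k := by exact_mod_cast hk
  have hj0 : (0 : ℝ) < (j : ℕ) := by
    have := Fin.val_ne_of_ne hj.1
    have : 0 < (j : ℕ) := Nat.pos_of_ne_zero (by simpa using this)
    exact_mod_cast this
  have hjk : ((j : ℕ) : ℝ) < k := by
    have h1 := Fin.val_ne_of_ne hj.2
    have h2 := j.isLt
    rw [Fin.val_last] at h1
    have : (j : ℕ) < k := by omega
    exact_mod_cast this
  -- The derivative bounds on the data are assumed only for `z` in the open interval, so the node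
  -- must be strictly interior.
  have hmem : (j : ℕ) * stepZ B k ∈ Ioo 0 B := by
    unfold stepZ
    refine ⟨by positivity, ?_⟩
    rw [mul_div_assoc', div_lt_iff₀ hk0]
    nlinarith
  have h := (hp s).2.2 φ _ hmem
  exact ⟨h.1.trans (le_abs_self _), h.2.trans (le_abs_self _)⟩

/-- The constant of the Volterra estimate of the nonlinear term. -/
def volterraConst (ε R B K h₀ κ Λ : ℝ) (N : ℕ) : ℝ :=
  ((1 / ε ^ 2 + 1) * ((2 + B) * κ * (2 * bracketBound ε R B K h₀ κ Λ N) *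
    (quotientLip ε B h₀ κ N * √(2 * (R - ε) + 2 * K)))) ^ 2

/-- The Volterra estimate of the nonlinear term. -/
theorem Setting.sq_nonlinearTerm_sub_le (hS : Setting ε R B h₀ κ N n k)
    (hp : IsTravelTimeData B Λ p) (hV : IsRegular ε R B K V) (hV' : IsRegular ε R B K V')
    (i : Fin (n + 1)) {j : Fin (k + 1)} (hj : IsInteriorZ j) (m : Fin N) {r : ℝ}
    (hr : r ∈ Icc ε R) :
    (nonlinearTerm R B p V i j m r - nonlinearTerm R B p V' i j m r) ^ 2 ≤
      volterraConst ε R B K h₀ κ Λ N * ∫ t in r..R, sumSq (V - V') t := by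
  have hr0 : 0 < r := hS.hε.trans_le hr.1
  have hdp := fun (φ : ℝ) (s : Fin N) => hp.abs_deriv_le hS.hB hS.hk hj φ s
  have h1 := abs_projDerivSq_bracket_sub_le hS.hε hS.hεR.le hS.hB.le hS.hh₀ hS.hκ hV hV'
    (hS.controlled_dPhi hV.memH i j) (hS.controlled_dPhi hV'.memH i j)
    (fun s r => by
      simpa only [dPhi_sub, Pi.sub_apply] using abs_dPhi_le hS.hh₀ hS.hφ (V - V') i j s r)
    (fun s => (hdp (i * stepPhi n) s).1) hr m
  have h2 := abs_projDerivSq_bracket_sub_le hS.hε hS.hεR.le hS.hB.le hS.hh₀ hS.hκ hV hV'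
    (hS.controlled_dZ hV.memH i j) (hS.controlled_dZ hV'.memH i j)
    (fun s r => by
      simpa only [dZ_sub, Pi.sub_apply] using abs_dZ_le hS.hh₀ hS.hz (V - V') i j s r)
    (fun s => (hdp (i * stepPhi n) s).2) hr m
  have hE : 0 ≤ ∫ t in r..R, sumSq (V - V') t :=
    intervalIntegral.integral_nonneg hr.2 fun t _ => sumSq_nonneg _ t
  rw [← mul_assoc] at h1 h2
  have hinv : 1 / r ^ 2 ≤ 1 / ε ^ 2 :=
    one_div_le_one_div_of_le (by have := hS.hε; positivity) (by have := hS.hε; gcongr; exact hr.1)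
  have hinv0 : 0 ≤ 1 / r ^ 2 := by positivity
  unfold volterraConst nonlinearTerm
  set X := √(∫ t in r..R, sumSq (V - V') t) with hX
  set Y := (2 + B) * κ * (2 * bracketBound ε R B K h₀ κ Λ N) *
    (quotientLip ε B h₀ κ N * √(2 * (R - ε) + 2 * K)) with hY
  have hXsq : X ^ 2 = ∫ t in r..R, sumSq (V - V') t := Real.sq_sqrt hE
  rw [← hXsq, ← mul_pow, ← sq_abs]
  refine pow_le_pow_left₀ (abs_nonneg _) ?_ 2
  rw [add_sub_add_comm, ← mul_sub, add_mul, add_mul, one_mul]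
  refine (abs_add_le _ _).trans (add_le_add ?_ h2)
  rw [abs_mul, abs_of_nonneg hinv0, mul_assoc]
  exact mul_le_mul hinv h1 (abs_nonneg _) (hinv0.trans hinv)

theorem Setting.continuousOn_nonlinearTerm (hS : Setting ε R B h₀ κ N n k) (hK : 0 ≤ K)
    (hp : IsTravelTimeData B Λ p) (hV : IsRegular ε R B K V)
    (i : Fin (n + 1)) {j : Fin (k + 1)} (hj : IsInteriorZ j) (m : Fin N) :
    ContinuousOn (nonlinearTerm R B p V i j m) (Icc ε R) := by
  have hdp := fun (φ : ℝ) (s : Fin N) => hp.abs_deriv_le hS.hB hS.hk hj φ s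
  refine ContinuousOn.add (ContinuousOn.mul ?_ ?_) ?_
  · refine continuousOn_const.div (continuousOn_id.pow 2) fun r hr => ?_
    have : 0 < r := hS.hε.trans_le hr.1
    exact (pow_pos this 2).ne'
  · exact continuousOn_projDerivSq_bracket hS.hε hS.hεR.le hS.hB.le hS.hh₀ hS.hκ hK hV
      (hS.controlled_dPhi hV.memH i j) (fun s => (hdp (i * stepPhi n) s).1) m
  · exact continuousOn_projDerivSq_bracket hS.hε hS.hεR.le hS.hB.le hS.hh₀ hS.hκ hK hV
      (hS.controlled_dZ hV.memH i j) (fun s => (hdp (i * stepPhi n) s).2) m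

theorem Setting.memLp_residual (hS : Setting ε R B h₀ κ N n k) (hK : 0 ≤ K)
    (hp : IsTravelTimeData B Λ p) (hV : IsRegular ε R B K V)
    (i : Fin (n + 1)) {j : Fin (k + 1)} (hj : IsInteriorZ j) (m : Fin N) :
    MemLp (residual R B p V i j m) 2 (volume.restrict (Ioo ε R)) := by
  have hc := hS.continuousOn_nonlinearTerm hK hp hV i hj m
  have h1 : MemLp (fun r => (basisMatrix B N).mulVec (fun s => V i j s r) m) 2
      (volume.restrict (Ioo ε R)) := by
    simp only [Matrix.mulVec, dotProduct]
    exact memLp_finsetSum _ fun s _ => (hV.memH i j s).const_mul _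
  obtain ⟨C, hC⟩ := isCompact_Icc.exists_bound_of_continuousOn hc
  have h2 : MemLp (nonlinearTerm R B p V i j m) 2 (volume.restrict (Ioo ε R)) := by
    refine MemLp.of_bound ((hc.mono Ioo_subset_Icc_self).aestronglyMeasurable measurableSet_Ioo) C ?_
    filter_upwards [ae_restrict_mem measurableSet_Ioo] with r hr
    exact hC r (Ioo_subset_Icc_self hr)
  exact h1.add h2

end Nonlinear

/-! ### Interior nodes, faces, and the functional -/

/-- The sum of the squares of the components of `F` at the interior nodes. -/
def interiorSq (F : SemiDiscrete N n k) (r : ℝ) : ℝ :=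
  ∑ i, ∑ j, if IsInteriorZ j then ∑ s, F i j s r ^ 2 else 0

/-- The sum of the squares of the components of `F` at the nodes on the faces. -/
def faceSq (F : SemiDiscrete N n k) (r : ℝ) : ℝ :=
  ∑ i, ∑ j, if IsInteriorZ j then 0 else ∑ s, F i j s r ^ 2

theorem interiorSq_nonneg (F : SemiDiscrete N n k) (r : ℝ) : 0 ≤ interiorSq F r :=
  Finset.sum_nonneg fun i _ => Finset.sum_nonneg fun j _ => by
    split_ifs
    · positivity
    · exact le_rfl

theorem faceSq_nonneg (F : SemiDiscrete N n k) (r : ℝ) : 0 ≤ faceSq F r :=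
  Finset.sum_nonneg fun i _ => Finset.sum_nonneg fun j _ => by
    split_ifs
    · exact le_rfl
    · positivity

theorem sumSq_eq_add (F : SemiDiscrete N n k) (r : ℝ) :
    sumSq F r = interiorSq F r + faceSq F r := by
  simp only [sumSq, interiorSq, faceSq, ← Finset.sum_add_distrib]
  refine Finset.sum_congr rfl fun i _ => Finset.sum_congr rfl fun j _ => ?_
  split_ifs <;> simp

theorem faceSq_le_sumSq (F : SemiDiscrete N n k) (r : ℝ) : faceSq F r ≤ sumSq F r := by
  rw [sumSq_eq_add]
  linarith [interiorSq_nonneg F r]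

theorem integrable_interiorSq {μ : Measure ℝ} {F : SemiDiscrete N n k}
    (hF : ∀ i j s, IsInteriorZ j → MemLp (F i j s) 2 μ) : Integrable (interiorSq F) μ :=
  integrable_finsetSum _ fun i _ => integrable_finsetSum _ fun j _ => by
    split_ifs with hj
    · exact integrable_finsetSum _ fun s _ => (hF i j s hj).integrable_sq
    · exact integrable_zero _ _ _

theorem integrable_faceSq {μ : Measure ℝ} {F : SemiDiscrete N n k}
    (hF : ∀ i j s, MemLp (F i j s) 2 μ) : Integrable (faceSq F) μ :=
  integrable_finsetSum _ fun i _ => integrable_finsetSum _ fun j _ => by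
    split_ifs with hj
    · exact integrable_zero _ _ _
    · exact integrable_finsetSum _ fun s _ => (hF i j s).integrable_sq

/-- An upper bound for the number of all components at all nodes. -/
def nodeBound (B h₀ : ℝ) (N : ℕ) : ℝ := (2 * Real.pi / h₀ + 1) * (B / h₀ + 1) * N

/-- The lower bound `h₀` on the steps forces `n ≤ 2π / h₀` and `k ≤ B / h₀`; this is why the final
constants do not depend on the grid. -/
theorem Setting.card_le {ε R B h₀ κ : ℝ} (hS : Setting ε R B h₀ κ N n k) :
    ((n : ℝ) + 1) * (k + 1) * N ≤ nodeBound B h₀ N := by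
  have hn : (0 : ℝ) < n := by exact_mod_cast hS.hn
  have hk : (0 : ℝ) < k := by exact_mod_cast hS.hk
  have h1 : (n : ℝ) ≤ 2 * Real.pi / h₀ := by
    have := hS.hφ
    unfold stepPhi at this
    rw [le_div_iff₀ hn] at this
    rw [le_div_iff₀ hS.hh₀]
    linarith
  have h2 : (k : ℝ) ≤ B / h₀ := by
    have := hS.hz
    unfold stepZ at this
    rw [le_div_iff₀ hk] at this
    rw [le_div_iff₀ hS.hh₀]
    linarith
  have hh := hS.hh₀
  have hp : 0 ≤ 2 * Real.pi / h₀ + 1 := by positivity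
  unfold nodeBound
  gcongr

theorem Setting.nodeBound_nonneg {ε R B h₀ κ : ℝ} (hS : Setting ε R B h₀ κ N n k) :
    0 ≤ nodeBound B h₀ N := le_trans (by positivity) hS.card_le

theorem Setting.interiorSq_le {ε R B h₀ κ : ℝ} (hS : Setting ε R B h₀ κ N n k)
    {F : SemiDiscrete N n k} {r b : ℝ} (hb : 0 ≤ b)
    (hF : ∀ i j s, IsInteriorZ j → F i j s r ^ 2 ≤ b) :
    interiorSq F r ≤ nodeBound B h₀ N * b := by
  have : interiorSq F r ≤ ∑ _i : Fin (n + 1), ∑ _j : Fin (k + 1), ∑ _s : Fin N, b := by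
    refine Finset.sum_le_sum fun i _ => Finset.sum_le_sum fun j _ => ?_
    split_ifs with hj
    · exact Finset.sum_le_sum fun s _ => hF i j s hj
    · exact Finset.sum_nonneg fun _ _ => hb
  refine this.trans ?_
  have e : ∑ _i : Fin (n + 1), ∑ _j : Fin (k + 1), ∑ _s : Fin N, b =
      ((n : ℝ) + 1) * (k + 1) * N * b := by
    simp
    ring
  rw [e]
  exact mul_le_mul_of_nonneg_right hS.card_le hb

theorem Setting.sumSq_le {ε R B h₀ κ : ℝ} (hS : Setting ε R B h₀ κ N n k)
    {F : SemiDiscrete N n k} {r b : ℝ} (hb : 0 ≤ b) (hF : ∀ i j s, F i j s r ^ 2 ≤ b) :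
    sumSq F r ≤ nodeBound B h₀ N * b := by
  have : sumSq F r ≤ ∑ _i : Fin (n + 1), ∑ _j : Fin (k + 1), ∑ _s : Fin N, b :=
    Finset.sum_le_sum fun i _ => Finset.sum_le_sum fun j _ => Finset.sum_le_sum fun s _ =>
      hF i j s
  refine this.trans ?_
  have e : ∑ _i : Fin (n + 1), ∑ _j : Fin (k + 1), ∑ _s : Fin N, b =
      ((n : ℝ) + 1) * (k + 1) * N * b := by
    simp
    ring
  rw [e]
  exact mul_le_mul_of_nonneg_right hS.card_le hb

/-- Equivalence of the `H_N^{1,h}` norm and the `L₂` norm on grids with bounded step sizes. -/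
theorem Setting.normH1h_sq_le {ε R B h₀ κ : ℝ} (hS : Setting ε R B h₀ κ N n k)
    {F : SemiDiscrete N n k} (hF : InH1h ε R F) :
    normH1h ε R B F ^ 2 ≤
      (2 * (nodeBound B h₀ N / h₀ ^ 2) + 1) * ∫ r in ε..R, sumSq F r := by
  have hεR := hS.hεR.le
  have hi : ∀ {G : SemiDiscrete N n k}, InH1h ε R G → IntervalIntegrable (sumSq G) volume ε R :=
    fun hG => intervalIntegrable_of_integrable_Ioo hεR hG.integrable_sumSq ⟨le_rfl, hεR⟩
      ⟨hεR, le_rfl⟩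
  have key : ∀ {G : SemiDiscrete N n k}, InH1h ε R G →
      (∀ i j s r, |G i j s r| ≤ magnitude F r / h₀) →
      normSqL2h ε R G ≤ nodeBound B h₀ N / h₀ ^ 2 * ∫ r in ε..R, sumSq F r := by
    intro G hG hle
    rw [hG.normSqL2h_eq hεR, ← intervalIntegral.integral_const_mul]
    refine intervalIntegral.integral_mono_on hεR (hi hG) ((hi hF).const_mul _) fun r _ => ?_
    have := hS.sumSq_le (F := G) (r := r) (b := (magnitude F r / h₀) ^ 2) (sq_nonneg _)
      fun i j s => by
        rw [← sq_abs]
        exact pow_le_pow_left₀ (abs_nonneg _) (hle i j s r) 2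
    refine this.trans (le_of_eq ?_)
    rw [div_pow, magnitude_sq]
    ring
  have h1 := key (hF.dZ B) fun i j s r => abs_dZ_le hS.hh₀ hS.hz F i j s r
  have h2 := key hF.dPhi fun i j s r => abs_dPhi_le hS.hh₀ hS.hφ F i j s r
  have h3 := hF.normSqL2h_eq hεR
  have h0 : 0 ≤ ∫ r in ε..R, sumSq F r :=
    intervalIntegral.integral_nonneg hεR fun r _ => sumSq_nonneg F r
  have hb := hS.nodeBound_nonneg
  have hsum : normSqL2h ε R (dZ B F) + normSqL2h ε R (dPhi F) + normSqL2h ε R F ≤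
      (2 * (nodeBound B h₀ N / h₀ ^ 2) + 1) * ∫ r in ε..R, sumSq F r := by
    rw [h3]
    linarith
  unfold normH1h
  rw [Real.sq_sqrt']
  exact max_le hsum (by positivity)

theorem normSqL2h_nonneg {ε R : ℝ} (hεR : ε ≤ R) (F : SemiDiscrete N n k) :
    0 ≤ normSqL2h ε R F :=
  Finset.sum_nonneg fun _ _ => Finset.sum_nonneg fun _ _ => Finset.sum_nonneg fun _ _ =>
    intervalIntegral.integral_nonneg hεR fun _ _ => sq_nonneg _

theorem InH1h.integral_sumSq_le {ε R : ℝ} (hεR : ε ≤ R) (B : ℝ) {F : SemiDiscrete N n k}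
    (hF : InH1h ε R F) : ∫ r in ε..R, sumSq F r ≤ normH1h ε R B F ^ 2 := by
  have h1 := normSqL2h_nonneg hεR (TravelTime.dZ B F)
  have h2 := normSqL2h_nonneg hεR (TravelTime.dPhi F)
  have h3 := normSqL2h_nonneg hεR F
  rw [normH1h, Real.sq_sqrt (by positivity), ← hF.normSqL2h_eq hεR]
  linarith

/-! ### The triangle inequality in `H_N^{1,h}` -/

/-- Along a line the squared norm is a quadratic polynomial. Its nonnegativity gives, through the
discriminant, the Cauchy–Schwarz inequality behind the triangle inequality. -/
theorem InH1h.exists_normSqL2h_smul_add {ε R : ℝ} (hεR : ε ≤ R) {F G : SemiDiscrete N n k}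
    (hF : InH1h ε R F) (hG : InH1h ε R G) :
    ∃ b : ℝ, ∀ t : ℝ, normSqL2h ε R (t • F + G) =
      normSqL2h ε R F * (t * t) + b * t + normSqL2h ε R G := by
  refine ⟨∑ i, ∑ j, ∑ s, 2 * ∫ r in ε..R, F i j s r * G i j s r, fun t => ?_⟩
  simp only [normSqL2h, Finset.sum_mul, ← Finset.sum_add_distrib]
  refine Finset.sum_congr rfl fun i _ => Finset.sum_congr rfl fun j _ =>
    Finset.sum_congr rfl fun s _ => ?_
  have hi : ∀ {g : ℝ → ℝ}, Integrable g (volume.restrict (Ioo ε R)) →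
      IntervalIntegrable g volume ε R := fun hg =>
    intervalIntegrable_of_integrable_Ioo hεR hg ⟨le_rfl, hεR⟩ ⟨hεR, le_rfl⟩
  have i1 := hi (hF i j s).integrable_sq
  have i2 := hi ((hF i j s).integrable_mul (hG i j s))
  have i3 := hi (hG i j s).integrable_sq
  have e : ∀ r, (t • F + G) i j s r ^ 2 =
      t * t * F i j s r ^ 2 + 2 * t * (F i j s r * G i j s r) + G i j s r ^ 2 := by
    intro r
    simp only [Pi.add_apply, Pi.smul_apply, smul_eq_mul]
    ring
  have i4 : IntervalIntegrable (fun r => 2 * t * (F i j s r * G i j s r)) volume ε R :=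
    i2.const_mul _
  have i5 : IntervalIntegrable (fun r => t * t * F i j s r ^ 2) volume ε R := i1.const_mul _
  simp only [e]
  rw [intervalIntegral.integral_add (i5.add i4) i3, intervalIntegral.integral_add i5 i4,
    intervalIntegral.integral_const_mul, intervalIntegral.integral_const_mul]
  ring

theorem dZ_smul_add (B t : ℝ) (F G : SemiDiscrete N n k) :
    dZ B (t • F + G) = t • dZ B F + dZ B G := by
  funext i j s r
  simp only [dZ, Pi.add_apply, Pi.smul_apply, smul_eq_mul]
  split_ifs <;> ring

theorem dPhi_smul_add (t : ℝ) (F G : SemiDiscrete N n k) :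
    dPhi (t • F + G) = t • dPhi F + dPhi G := by
  funext i j s r
  simp only [dPhi, Pi.add_apply, Pi.smul_apply, smul_eq_mul]
  ring

theorem InH1h.normH1h_add_le {ε R : ℝ} (hεR : ε ≤ R) (B : ℝ) {F G : SemiDiscrete N n k}
    (hF : InH1h ε R F) (hG : InH1h ε R G) :
    normH1h ε R B (F + G) ≤ normH1h ε R B F + normH1h ε R B G := by
  obtain ⟨b₁, h₁⟩ := (hF.dZ B).exists_normSqL2h_smul_add hεR (hG.dZ B)
  obtain ⟨b₂, h₂⟩ := hF.dPhi.exists_normSqL2h_smul_add hεR hG.dPhi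
  obtain ⟨b₃, h₃⟩ := hF.exists_normSqL2h_smul_add hεR hG
  set Q : SemiDiscrete N n k → ℝ := fun U => normSqL2h ε R (TravelTime.dZ B U) +
    normSqL2h ε R (TravelTime.dPhi U) + normSqL2h ε R U with hQ
  have hQ0 : ∀ U, 0 ≤ Q U := fun U => add_nonneg (add_nonneg (normSqL2h_nonneg hεR _)
    (normSqL2h_nonneg hεR _)) (normSqL2h_nonneg hεR _)
  have hquad : ∀ t : ℝ, Q (t • F + G) = Q F * (t * t) + (b₁ + b₂ + b₃) * t + Q G := by
    intro t
    simp only [hQ, dZ_smul_add, dPhi_smul_add, h₁, h₂, h₃]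
    ring
  have hdisc := discrim_le_zero fun t => (hquad t) ▸ hQ0 (t • F + G)
  rw [discrim] at hdisc
  have h1 := hquad 1
  rw [one_smul] at h1
  change √(Q (F + G)) ≤ √(Q F) + √(Q G)
  have hF2 := Real.sq_sqrt (hQ0 F)
  have hG2 := Real.sq_sqrt (hQ0 G)
  have hb : b₁ + b₂ + b₃ ≤ 2 * (√(Q F) * √(Q G)) := by
    refine le_of_sq_le_sq ?_ (by positivity)
    rw [mul_pow, mul_pow, hF2, hG2]
    linarith
  refine Real.sqrt_le_iff.2 ⟨by positivity, ?_⟩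
  rw [h1]
  nlinarith

/-! ### The closure of the admissible set -/

/-- The pointwise infimum of the functions has integral zero, so it vanishes almost everywhere. The
index may depend on `r`, which is enough to pass closed pointwise conditions to the limit. -/
theorem ae_forall_exists_lt {μ : Measure ℝ} {h : ℕ → ℝ → ℝ} (h0 : ∀ m r, 0 ≤ h m r)
    (hi : ∀ m, Integrable (h m) μ) (hlim : ∀ η > 0, ∃ m, ∫ r, h m r ∂μ < η) :
    ∀ᵐ r ∂μ, ∀ η > 0, ∃ m, h m r < η := by
  have hmeas : ∀ m, AEMeasurable (fun r => ENNReal.ofReal (h m r)) μ := fun m =>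
    (hi m).aestronglyMeasurable.aemeasurable.ennreal_ofReal
  have hzero : ∫⁻ r, ⨅ m, ENNReal.ofReal (h m r) ∂μ = 0 := by
    refine le_antisymm (ENNReal.le_of_forall_pos_le_add fun η hη _ => ?_) zero_le
    obtain ⟨m, hm⟩ := hlim η (by exact_mod_cast hη)
    rw [zero_add]
    calc ∫⁻ r, ⨅ m, ENNReal.ofReal (h m r) ∂μ ≤ ∫⁻ r, ENNReal.ofReal (h m r) ∂μ :=
          lintegral_mono fun r => iInf_le _ m
      _ = ENNReal.ofReal (∫ r, h m r ∂μ) :=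
          (ofReal_integral_eq_lintegral_ofReal (hi m) (ae_of_all _ (h0 m))).symm
      _ ≤ ENNReal.ofReal η := ENNReal.ofReal_le_ofReal hm.le
      _ = η := ENNReal.ofReal_coe_nnreal
  rw [lintegral_eq_zero_iff' (AEMeasurable.iInf hmeas)] at hzero
  filter_upwards [hzero] with r hr η hη
  have : ⨅ m, ENNReal.ofReal (h m r) < ENNReal.ofReal η := by
    rw [show ⨅ m, ENNReal.ofReal (h m r) = 0 from hr]
    exact ENNReal.ofReal_pos.2 hη
  obtain ⟨m, hm⟩ := iInf_lt_iff.1 this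
  exact ⟨m, (ENNReal.ofReal_lt_ofReal_iff hη).1 hm⟩

theorem eq_of_forall_abs_sub_lt {x y : ℝ} (h : ∀ η > 0, |x - y| < η) : x = y := by
  by_contra hne
  exact lt_irrefl _ (h _ (abs_pos.2 (sub_ne_zero.2 hne)))

section Closure

variable {ε R B κ M : ℝ} {V : SemiDiscrete N n k} {G₀ G_B : FaceData N n}

theorem normH1h_nonneg (F : SemiDiscrete N n k) : 0 ≤ normH1h ε R B F := Real.sqrt_nonneg _

/-- Pointwise approximation of the elements of the closure. -/
theorem exists_approximation (hεR : ε ≤ R) {X : Set (SemiDiscrete N n k)}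
    (hX : ∀ W ∈ X, InH1h ε R W) (hV : V ∈ closureH1h ε R B X) :
    ∃ W : ℕ → SemiDiscrete N n k, (∀ m, W m ∈ X) ∧ (∀ m, normH1h ε R B (V - W m) < 1) ∧
      ∀ᵐ r ∂(volume.restrict (Ioo ε R)), ∀ η > 0, ∃ m, magnitude (V - W m) r < η := by
  have hpos : ∀ m : ℕ, (0 : ℝ) < 1 / (m + 1) := fun m => Nat.one_div_pos_of_nat
  have hle1 : ∀ m : ℕ, (1 : ℝ) / (m + 1) ≤ 1 := fun m =>
    (div_le_one (by positivity)).2 (by linarith [(Nat.cast_nonneg m : (0 : ℝ) ≤ m)])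
  choose W hW hlt using fun m : ℕ => hV.2 (1 / (m + 1)) (hpos m)
  refine ⟨W, hW, fun m => (hlt m).trans_le (hle1 m), ?_⟩
  have hmem : ∀ m, InH1h ε R (V - W m) := fun m => hV.1.sub (hX _ (hW m))
  have hae := ae_forall_exists_lt (μ := volume.restrict (Ioo ε R))
    (h := fun m => sumSq (V - W m)) (fun m r => sumSq_nonneg _ _)
    (fun m => (hmem m).integrable_sumSq) fun η hη => by
      obtain ⟨m, hm⟩ := exists_nat_one_div_lt hη
      refine ⟨m, lt_of_le_of_lt ?_ hm⟩
      have h1 := (hmem m).integral_sumSq_le hεR B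
      rw [intervalIntegral.integral_of_le hεR, integral_Ioc_eq_integral_Ioo] at h1
      have h2 := hlt m
      have h3 : 0 ≤ normH1h ε R B (V - W m) := normH1h_nonneg _
      have h4 := h2.trans_le (hle1 m)
      nlinarith
  filter_upwards [hae] with r hr η hη
  obtain ⟨m, hm⟩ := hr (η ^ 2) (by positivity)
  refine ⟨m, ?_⟩
  rw [← magnitude_sq] at hm
  exact lt_of_pow_lt_pow_left₀ 2 hη.le hm

/-- The lower bound, the face data and the periodicity are closed pointwise conditions, and
countably many approximants share one null set. For the size, one approximant at distance below `1`
and `‖V‖² ≤ 2‖W‖² + 2‖V - W‖²` give `2M² + 2`. -/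
theorem closure_isRegular (hεR : ε ≤ R) (hκ : BoundsBasis B N κ)
    (hV : V ∈ closureH1h ε R B (admissible ε R B M k G₀ G_B)) :
    IsRegular ε R B (2 * M ^ 2 + 2) V ∧ HasFaceData ε R G₀ G_B V ∧ IsPeriodicPhi ε R V := by
  obtain ⟨W, hW, hlt, hae⟩ := exists_approximation hεR (fun _ h => h.1) hV
  have hcomp : ∀ {m : ℕ} {r η : ℝ}, magnitude (V - W m) r < η → ∀ i j s,
      |V i j s r - W m i j s r| < η := fun h i j s =>
    (abs_le_magnitude (V - W _) i j s _).trans_lt h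
  refine ⟨⟨hV.1, fun i j => ?_, ?_⟩, fun i s => ⟨?_, ?_⟩, fun j s => ?_⟩
  · filter_upwards [hae, ae_all_iff.2 fun m => (hW m).2.1 i j] with r hr hlow z hz
    refine le_of_forall_pos_le_add fun η hη => ?_
    have hκ0 := hκ.1
    obtain ⟨m, hm⟩ := hr (η / (N * κ + 1)) (by positivity)
    have h1 := abs_series_le hκ (V - W m) i j hz r
    rw [series_sub] at h1
    rw [lt_div_iff₀ (by positivity)] at hm
    have h2 := hlow m z hz
    have h3 := magnitude_nonneg (V - W m) r
    have h4 := (abs_le.1 h1).1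
    nlinarith
  · have hW0 := hW 0
    have hd := hV.1.sub hW0.1
    have hi : ∀ {F : SemiDiscrete N n k}, InH1h ε R F → IntervalIntegrable (sumSq F) volume ε R :=
      fun hF => intervalIntegrable_of_integrable_Ioo hεR hF.integrable_sumSq ⟨le_rfl, hεR⟩
        ⟨hεR, le_rfl⟩
    have h1 : ∫ r in ε..R, sumSq V r ≤
        ∫ r in ε..R, (2 * sumSq (W 0) r + 2 * sumSq (V - W 0) r) := by
      refine intervalIntegral.integral_mono_on hεR (hi hV.1)
        (((hi hW0.1).const_mul 2).add ((hi hd).const_mul 2)) fun r _ => ?_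
      simp only [sumSq, Finset.mul_sum, ← Finset.sum_add_distrib]
      refine Finset.sum_le_sum fun i _ => Finset.sum_le_sum fun j _ => Finset.sum_le_sum
        fun s _ => ?_
      simp only [Pi.sub_apply]
      -- The identity used is `2w² + 2(v - w)² - v² = (v - 2w)²`.
      nlinarith [sq_nonneg (V i j s r - 2 * W 0 i j s r)]
    rw [intervalIntegral.integral_add ((hi hW0.1).const_mul 2) ((hi hd).const_mul 2),
      intervalIntegral.integral_const_mul, intervalIntegral.integral_const_mul] at h1
    have h2 := hW0.1.integral_sumSq_le hεR B
    have h3 := hd.integral_sumSq_le hεR B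
    have h4 := hW0.2.2.1
    have h5 : 0 ≤ normH1h ε R B (W 0) := normH1h_nonneg _
    have h6 : 0 ≤ normH1h ε R B (V - W 0) := normH1h_nonneg _
    have h7 := hlt 0
    nlinarith
  · filter_upwards [hae, ae_all_iff.2 fun m => ((hW m).2.2.2.1 i s).1] with r hr h
    refine eq_of_forall_abs_sub_lt fun η hη => ?_
    obtain ⟨m, hm⟩ := hr η hη
    rw [← h m]
    exact hcomp hm i 0 s
  · filter_upwards [hae, ae_all_iff.2 fun m => ((hW m).2.2.2.1 i s).2] with r hr h
    refine eq_of_forall_abs_sub_lt fun η hη => ?_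
    obtain ⟨m, hm⟩ := hr η hη
    rw [← h m]
    exact hcomp hm i (Fin.last k) s
  · filter_upwards [hae, ae_all_iff.2 fun m => (hW m).2.2.2.2 j s] with r hr h
    refine eq_of_forall_abs_sub_lt fun η hη => ?_
    obtain ⟨m, hm⟩ := hr (η / 2) (by positivity)
    have h1 := abs_lt.1 (hcomp hm 0 j s)
    have h2 := abs_lt.1 (hcomp hm (Fin.last n) j s)
    rw [h m] at h1
    rw [abs_lt]
    constructor <;> linarith [h1.1, h1.2, h2.1, h2.2]

theorem subset_closureH1h {X : Set (SemiDiscrete N n k)} (hX : ∀ W ∈ X, InH1h ε R W) :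
    X ⊆ closureH1h ε R B X := fun W hW => by
  refine ⟨hX W hW, fun η hη => ⟨W, hW, ?_⟩⟩
  have : normH1h ε R B (W - W) = 0 := by
    rw [sub_self]
    simp [normH1h, normSqL2h, dZ, dPhi]
  rwa [this]

end Closure

/-! ### The competitor -/

/-- `U` at the interior nodes for `r ≤ ρ`, and `V` elsewhere. -/
def splice (ρ : ℝ) (U V : SemiDiscrete N n k) : SemiDiscrete N n k := fun i j s r =>
  if IsInteriorZ j ∧ r ≤ ρ then U i j s r else V i j s r

section Splice

variable {ε R ρ : ℝ} {U V : SemiDiscrete N n k}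

theorem splice_of_interior {i : Fin (n + 1)} {j : Fin (k + 1)} {s : Fin N} {r : ℝ}
    (hj : IsInteriorZ j) (hr : r ≤ ρ) : splice ρ U V i j s r = U i j s r := if_pos ⟨hj, hr⟩

theorem splice_of_face {i : Fin (n + 1)} {j : Fin (k + 1)} {s : Fin N} {r : ℝ}
    (hj : ¬IsInteriorZ j) : splice ρ U V i j s r = V i j s r := if_neg fun h => hj h.1

theorem splice_of_lt {i : Fin (n + 1)} {j : Fin (k + 1)} {s : Fin N} {r : ℝ}
    (hr : ρ < r) : splice ρ U V i j s r = V i j s r := if_neg fun h => hr.not_ge h.2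

theorem InH1h.splice (hU : InH1h ε R U) (hV : InH1h ε R V) (ρ : ℝ) :
    InH1h ε R (splice ρ U V) := fun i j s => by
  by_cases hj : IsInteriorZ j
  · have e : TravelTime.splice ρ U V i j s = (Iic ρ).piecewise (U i j s) (V i j s) := by
      funext r
      simp only [TravelTime.splice, hj, true_and, piecewise, mem_Iic]
    rw [e]
    exact MemLp.piecewise measurableSet_Iic ((hU i j s).restrict _) ((hV i j s).restrict _)
  · have e : TravelTime.splice ρ U V i j s = V i j s := by
      funext r
      exact splice_of_face hj
    rw [e]
    exact hV i j s

/-- At each point the values of `splice ρ U V` at a node are those of `U` or those of `V`. -/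
theorem splice_eq_or (i : Fin (n + 1)) (j : Fin (k + 1)) (r : ℝ) :
    (∀ s, splice ρ U V i j s r = U i j s r) ∨ ∀ s, splice ρ U V i j s r = V i j s r := by
  by_cases h : IsInteriorZ j ∧ r ≤ ρ
  · exact Or.inl fun s => if_pos h
  · exact Or.inr fun s => if_neg h

theorem lower_splice {B c : ℝ} {μ : Measure ℝ} {i : Fin (n + 1)} {j : Fin (k + 1)}
    (hU : ∀ᵐ r ∂μ, ∀ z ∈ Icc 0 B, c ≤ series B U i j z r)
    (hV : ∀ᵐ r ∂μ, ∀ z ∈ Icc 0 B, c ≤ series B V i j z r) :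
    ∀ᵐ r ∂μ, ∀ z ∈ Icc 0 B, c ≤ series B (splice ρ U V) i j z r := by
  filter_upwards [hU, hV] with r h1 h2 z hz
  rcases splice_eq_or (ρ := ρ) (U := U) (V := V) i j r with h | h
  · simpa only [series, h] using h1 z hz
  · simpa only [series, h] using h2 z hz

theorem sumSq_splice_sub_of_le {r : ℝ} (hr : r ≤ ρ) :
    sumSq (splice ρ U V - U) r = faceSq (V - U) r := by
  simp only [sumSq, faceSq]
  refine Finset.sum_congr rfl fun i _ => Finset.sum_congr rfl fun j _ => ?_
  split_ifs with hj
  · refine Finset.sum_eq_zero fun s _ => ?_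
    simp [splice_of_interior hj hr]
  · refine Finset.sum_congr rfl fun s _ => ?_
    simp [splice_of_face hj]

theorem sumSq_splice_sub_of_lt {r : ℝ} (hr : ρ < r) :
    sumSq (splice ρ U V - U) r = sumSq (V - U) r := by
  simp only [sumSq, Pi.sub_apply, splice_of_lt hr]

/-- Below `ρ` the competitor differs from `U` only on the faces, above `ρ` it is `V`. Hence the
interior error enters only through `[ρ, R]`, the part already controlled. -/
theorem integral_sumSq_splice_sub_le (hεR : ε ≤ R) (hU : InH1h ε R U) (hV : InH1h ε R V)
    (hρ : ρ ∈ Icc ε R) {r : ℝ} (hr : r ∈ Icc ε ρ) :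
    ∫ t in r..R, sumSq (splice ρ U V - U) t ≤
      (∫ t in ε..R, faceSq (V - U) t) + ∫ t in ρ..R, interiorSq (V - U) t := by
  have hd := hV.sub hU
  have hrR : r ∈ Icc ε R := ⟨hr.1, hr.2.trans hρ.2⟩
  have hRR : R ∈ Icc ε R := ⟨hεR, le_rfl⟩
  have hεε : ε ∈ Icc ε R := ⟨le_rfl, hεR⟩
  have iS := ((hU.splice hV ρ).sub hU).integrable_sumSq
  have iF := integrable_faceSq hd
  have iI := integrable_interiorSq fun i j s _ => hd i j s
  have e1 : ∫ t in r..ρ, sumSq (TravelTime.splice ρ U V - U) t = ∫ t in r..ρ, faceSq (V - U) t := by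
    refine intervalIntegral.integral_congr fun t ht => ?_
    rw [uIcc_of_le hr.2] at ht
    exact sumSq_splice_sub_of_le ht.2
  have e2 : ∫ t in ρ..R, sumSq (TravelTime.splice ρ U V - U) t =
      (∫ t in ρ..R, interiorSq (V - U) t) + ∫ t in ρ..R, faceSq (V - U) t := by
    rw [← intervalIntegral.integral_add (intervalIntegrable_of_integrable_Ioo hεR iI hρ hRR)
      (intervalIntegrable_of_integrable_Ioo hεR iF hρ hRR)]
    refine intervalIntegral.integral_congr_ae (Filter.Eventually.of_forall fun t ht => ?_)
    rw [uIoc_of_le hρ.2] at ht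
    rw [sumSq_splice_sub_of_lt ht.1, sumSq_eq_add]
  rw [← intervalIntegral.integral_add_adjacent_intervals
    (intervalIntegrable_of_integrable_Ioo hεR iS hrR hρ)
    (intervalIntegrable_of_integrable_Ioo hεR iS hρ hRR), e1, e2]
  have e3 : ∫ t in ε..R, faceSq (V - U) t = (∫ t in ε..r, faceSq (V - U) t) +
      ((∫ t in r..ρ, faceSq (V - U) t) + ∫ t in ρ..R, faceSq (V - U) t) := by
    rw [intervalIntegral.integral_add_adjacent_intervals
      (intervalIntegrable_of_integrable_Ioo hεR iF hrR hρ)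
      (intervalIntegrable_of_integrable_Ioo hεR iF hρ hRR),
      intervalIntegral.integral_add_adjacent_intervals
      (intervalIntegrable_of_integrable_Ioo hεR iF hεε hrR)
      (intervalIntegrable_of_integrable_Ioo hεR iF hrR hRR)]
  have h0 : 0 ≤ ∫ t in ε..r, faceSq (V - U) t :=
    intervalIntegral.integral_nonneg hr.1 fun t _ => faceSq_nonneg _ t
  linarith

end Splice

/-- The residual at `r` depends only on the values on `[r, R]`. -/
theorem residual_congr {R B : ℝ} {p : Fin N → ℝ → ℝ → ℝ} {V W : SemiDiscrete N n k} {r : ℝ}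
    (hr : r ≤ R) (h : ∀ t ∈ Icc r R, ∀ i j s, W i j s t = V i j s t) (i : Fin (n + 1))
    (j : Fin (k + 1)) (m : Fin N) : residual R B p W i j m r = residual R B p V i j m r := by
  have hbr : ∀ (D D' : SemiDiscrete N n k) (dp : Fin N → ℝ),
      (∀ t ∈ Icc r R, ∀ s, D i j s t = D' i j s t) →
      bracket R B W D dp i j r = bracket R B V D' dp i j r := by
    intro D D' dp hD
    funext z
    unfold bracket
    congr 2
    refine intervalIntegral.integral_congr fun t ht => ?_
    rw [uIcc_of_le hr] at ht
    simp only [series, h t ht, hD t ht]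
  unfold residual nonlinearTerm
  rw [hbr (dPhi W) (dPhi V) _ fun t ht s => by simp only [dPhi, h t ht],
    hbr (dZ B W) (dZ B V) _ fun t ht s => by simp only [dZ, h t ht]]
  simp only [h r ⟨le_rfl, hr⟩]

/-! ### Estimates of the residual -/

section Residual

variable {ε R B K h₀ κ Λ : ℝ} {V U W : SemiDiscrete N n k} {p : Fin N → ℝ → ℝ → ℝ}

theorem Setting.functionalJ_eq (hS : Setting ε R B h₀ κ N n k) (hK : 0 ≤ K)
    (hp : IsTravelTimeData B Λ p) (hV : IsRegular ε R B K V) (lam : ℝ) :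
    functionalJ ε R B p lam V =
      ∫ r in ε..R, interiorSq (residual R B p V) r * Real.exp (2 * lam * r) := by
  have hεR := hS.hεR.le
  have hi : ∀ i (j : Fin (k + 1)), IsInteriorZ j → ∀ m, IntervalIntegrable
      (fun r => (residual R B p V i j m r * Real.exp (lam * r)) ^ 2) volume ε R := by
    intro i j hj m
    have h1 := intervalIntegrable_of_integrable_Ioo hεR
      (hS.memLp_residual hK hp hV i hj m).integrable_sq ⟨le_rfl, hεR⟩ ⟨hεR, le_rfl⟩
    have h2 := h1.mul_continuousOn (g := fun r => Real.exp (lam * r) ^ 2) (by fun_prop)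
    simpa only [mul_pow] using h2
  have hi2 : ∀ i (j : Fin (k + 1)), IntervalIntegrable (fun r => if IsInteriorZ j then
      ∑ m, (residual R B p V i j m r * Real.exp (lam * r)) ^ 2 else 0) volume ε R := by
    intro i j
    split_ifs with hj
    · simpa only [Finset.sum_fn] using IntervalIntegrable.sum Finset.univ fun m _ => hi i j hj m
    · exact intervalIntegrable_const
  have hi3 : ∀ i, IntervalIntegrable (fun r => ∑ j : Fin (k + 1), if IsInteriorZ j then
      ∑ m, (residual R B p V i j m r * Real.exp (lam * r)) ^ 2 else 0) volume ε R := by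
    intro i
    simpa only [Finset.sum_fn] using IntervalIntegrable.sum Finset.univ fun j _ => hi2 i j
  have e : ∀ r, interiorSq (residual R B p V) r * Real.exp (2 * lam * r) =
      ∑ i, ∑ j, if IsInteriorZ j then
        ∑ m, (residual R B p V i j m r * Real.exp (lam * r)) ^ 2 else 0 := by
    intro r
    have hexp : Real.exp (2 * lam * r) = Real.exp (lam * r) ^ 2 := by
      rw [← Real.exp_nat_mul]
      push_cast
      ring_nf
    simp only [interiorSq, Finset.sum_mul]
    refine Finset.sum_congr rfl fun i _ => Finset.sum_congr rfl fun j _ => ?_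
    split_ifs with hj
    · rw [Finset.sum_mul]
      exact Finset.sum_congr rfl fun m _ => by rw [mul_pow, hexp]
    · rw [zero_mul]
  simp only [e]
  rw [intervalIntegral.integral_finsetSum fun i _ => hi3 i]
  refine Finset.sum_congr rfl fun i _ => ?_
  rw [intervalIntegral.integral_finsetSum fun j _ => hi2 i j]
  refine Finset.sum_congr rfl fun j _ => ?_
  split_ifs with hj
  · rw [intervalIntegral.integral_finsetSum fun m _ => hi i j hj m]
  · simp

theorem SolvesEquation.ae_all (hU : SolvesEquation ε R B p U) :
    ∀ᵐ r ∂(volume.restrict (Ioo ε R)), ∀ i j, IsInteriorZ j → ∀ m,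
      residual R B p U i j m r = 0 := by
  refine ae_all_iff.2 fun i => ae_all_iff.2 fun j => ?_
  by_cases hj : IsInteriorZ j
  · filter_upwards [ae_all_iff.2 fun m => hU i j hj m] with r hr _ using hr
  · exact ae_of_all _ fun r h => absurd h hj

/-- Subtracting the two equations, `A_N (V - U)` is the residual of `V` minus the difference of the
nonlinear terms; `α` bounds the inverse of `A_N`. -/
theorem sum_sq_sub_le_residual {α : ℝ} (hα0 : 0 ≤ α)
    (hα : ∀ v : Fin N → ℝ, ∑ s, v s ^ 2 ≤ α * ∑ m, (basisMatrix B N).mulVec v m ^ 2)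
    (i : Fin (n + 1)) (j : Fin (k + 1)) (r : ℝ)
    (hU : ∀ m, residual R B p U i j m r = 0) :
    ∑ s, (V - U) i j s r ^ 2 ≤ α * (2 * ∑ m, residual R B p V i j m r ^ 2 +
      2 * ∑ m, (nonlinearTerm R B p V - nonlinearTerm R B p U : SemiDiscrete N n k) i j m r ^ 2)
      := by
  refine (hα _).trans (mul_le_mul_of_nonneg_left ?_ hα0)
  rw [Finset.mul_sum, Finset.mul_sum, ← Finset.sum_add_distrib]
  refine Finset.sum_le_sum fun m _ => ?_
  have hsub : (basisMatrix B N).mulVec (fun s => (V - U) i j s r) m =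
      (basisMatrix B N).mulVec (fun s => V i j s r) m -
        (basisMatrix B N).mulVec (fun s => U i j s r) m := by
    have : (fun s => (V - U) i j s r) = (fun s => V i j s r) - fun s => U i j s r := rfl
    rw [this, Matrix.mulVec_sub, Pi.sub_apply]
  have h0 := hU m
  unfold residual at h0
  have e : (basisMatrix B N).mulVec (fun s => (V - U) i j s r) m =
      residual R B p V i j m r -
        (nonlinearTerm R B p V - nonlinearTerm R B p U : SemiDiscrete N n k) i j m r := by
    rw [hsub, residual, Pi.sub_apply, Pi.sub_apply, Pi.sub_apply, Pi.sub_apply]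
    linarith
  rw [e]
  nlinarith [sq_nonneg (residual R B p V i j m r +
    (nonlinearTerm R B p V - nonlinearTerm R B p U : SemiDiscrete N n k) i j m r)]

/-- The error at the interior nodes is controlled by the residual and by a Volterra term. -/
theorem Setting.ae_interiorSq_sub_le (hS : Setting ε R B h₀ κ N n k)
    (hp : IsTravelTimeData B Λ p) (hV : IsRegular ε R B K V) (hU : IsRegular ε R B K U)
    (hsol : SolvesEquation ε R B p U) {α : ℝ} (hα0 : 0 ≤ α)
    (hα : ∀ v : Fin N → ℝ, ∑ s, v s ^ 2 ≤ α * ∑ m, (basisMatrix B N).mulVec v m ^ 2) :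
    ∀ᵐ r ∂(volume.restrict (Ioo ε R)), interiorSq (V - U) r ≤
      α * (2 * interiorSq (residual R B p V) r +
        2 * (nodeBound B h₀ N * (volterraConst ε R B K h₀ κ Λ N *
          ∫ t in r..R, sumSq (V - U) t))) := by
  filter_upwards [hsol.ae_all, ae_restrict_mem measurableSet_Ioo] with r hr hmem
  have hE : 0 ≤ ∫ t in r..R, sumSq (V - U) t :=
    intervalIntegral.integral_nonneg hmem.2.le fun t _ => sumSq_nonneg _ t
  have h1 := hS.interiorSq_le
    (F := (nonlinearTerm R B p V - nonlinearTerm R B p U : SemiDiscrete N n k)) (r := r)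
    (mul_nonneg (sq_nonneg _) hE : 0 ≤ volterraConst ε R B K h₀ κ Λ N * _)
    fun i j m hj => hS.sq_nonlinearTerm_sub_le hp hV hU i hj m (Ioo_subset_Icc_self hmem)
  have h2 : interiorSq (V - U) r ≤ α * (2 * interiorSq (residual R B p V) r +
      2 * interiorSq (nonlinearTerm R B p V - nonlinearTerm R B p U : SemiDiscrete N n k) r) := by
    simp only [interiorSq, Finset.mul_sum, ← Finset.sum_add_distrib]
    refine Finset.sum_le_sum fun i _ => Finset.sum_le_sum fun j _ => ?_
    split_ifs with hj
    · exact sum_sq_sub_le_residual hα0 hα i j r (hr i j hj)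
    · simp
  refine h2.trans (mul_le_mul_of_nonneg_left ?_ hα0)
  linarith

/-- The residual of the competitor below `ρ`. -/
theorem Setting.ae_interiorSq_residual_splice_le (hS : Setting ε R B h₀ κ N n k)
    (hp : IsTravelTimeData B Λ p) (hU : IsRegular ε R B K U)
    (hsol : SolvesEquation ε R B p U) {ρ : ℝ} (hW : IsRegular ε R B K (splice ρ U V)) :
    ∀ᵐ r ∂(volume.restrict (Ioo ε R)), r ≤ ρ →
      interiorSq (residual R B p (splice ρ U V)) r ≤
        nodeBound B h₀ N * (volterraConst ε R B K h₀ κ Λ N *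
          ∫ t in r..R, sumSq (splice ρ U V - U) t) := by
  filter_upwards [hsol.ae_all, ae_restrict_mem measurableSet_Ioo] with r hr hmem hrρ
  have hE : 0 ≤ ∫ t in r..R, sumSq (splice ρ U V - U) t :=
    intervalIntegral.integral_nonneg hmem.2.le fun t _ => sumSq_nonneg _ t
  refine hS.interiorSq_le (mul_nonneg (sq_nonneg _) hE) fun i j m hj => ?_
  -- At interior nodes the competitor equals `U` at this `r`, so the linear parts cancel and only
  -- Volterra terms are left.
  have e : residual R B p (splice ρ U V) i j m r =
      nonlinearTerm R B p (splice ρ U V) i j m r - nonlinearTerm R B p U i j m r := by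
    have h0 := hr i j hj m
    unfold residual at h0 ⊢
    simp only [splice_of_interior hj hrρ]
    linarith
  rw [e]
  exact hS.sq_nonlinearTerm_sub_le hp hW hU i hj m (Ioo_subset_Icc_self hmem)

/-- Comparison of a minimizer with the competitor. -/
theorem Setting.integral_residual_le_of_functionalJ_le (hS : Setting ε R B h₀ κ N n k)
    (hK : 0 ≤ K) (hp : IsTravelTimeData B Λ p) (hV : IsRegular ε R B K V)
    (hU : IsRegular ε R B K U) (hsol : SolvesEquation ε R B p U) {ρ lam a : ℝ}
    (hρ : ρ ∈ Icc ε R) (hW : IsRegular ε R B K (splice ρ U V))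
    (hface : ∫ r in ε..R, faceSq (V - U) r ≤ a)
    (hJ : functionalJ ε R B p lam V ≤ functionalJ ε R B p lam (splice ρ U V)) :
    ∫ r in ε..ρ, interiorSq (residual R B p V) r * Real.exp (2 * lam * r) ≤
      nodeBound B h₀ N * volterraConst ε R B K h₀ κ Λ N *
        (a + ∫ r in ρ..R, interiorSq (V - U) r) * ∫ r in ε..ρ, Real.exp (2 * lam * r) := by
  have hεR := hS.hεR.le
  have hεε : ε ∈ Icc ε R := ⟨le_rfl, hεR⟩
  have hRR : R ∈ Icc ε R := ⟨hεR, le_rfl⟩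
  have hexp := continuous_exp_two_mul lam
  have hint : ∀ {F : SemiDiscrete N n k}, IsRegular ε R B K F → ∀ {x y : ℝ}, x ∈ Icc ε R →
      y ∈ Icc ε R → IntervalIntegrable
        (fun r => interiorSq (residual R B p F) r * Real.exp (2 * lam * r)) volume x y :=
    fun hF _ _ hx hy => (intervalIntegrable_of_integrable_Ioo hεR
      (integrable_interiorSq fun i j m hj => hS.memLp_residual hK hp hF i hj m)
        hx hy).mul_continuousOn hexp.continuousOn
  rw [hS.functionalJ_eq hK hp hV, hS.functionalJ_eq hK hp hW,
    ← intervalIntegral.integral_add_adjacent_intervals (hint hV hεε hρ) (hint hV hρ hRR),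
    ← intervalIntegral.integral_add_adjacent_intervals (hint hW hεε hρ) (hint hW hρ hRR)] at hJ
  -- Above `ρ` the competitor is `V`, and the residual looks only upwards. These contributions
  -- cancel, leaving a comparison on `[ε, ρ]`.
  have htop : ∫ r in ρ..R, interiorSq (residual R B p (splice ρ U V)) r *
      Real.exp (2 * lam * r) =
      ∫ r in ρ..R, interiorSq (residual R B p V) r * Real.exp (2 * lam * r) := by
    refine intervalIntegral.integral_congr_ae (Filter.Eventually.of_forall fun r hr => ?_)
    rw [uIoc_of_le hρ.2] at hr
    have := residual_congr (B := B) (p := p) (W := splice ρ U V) (V := V) hr.2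
      fun t ht i j s => splice_of_lt (hr.1.trans_le ht.1)
    simp only [interiorSq, this]
  rw [htop] at hJ
  refine (le_of_add_le_add_right hJ).trans ?_
  rw [← intervalIntegral.integral_const_mul]
  refine intervalIntegral.integral_mono_ae_restrict hρ.1 (hint hW hεε hρ)
    ((hexp.intervalIntegrable _ _).const_mul _) ?_
  have hsub : ∀ᵐ r ∂(volume.restrict (Icc ε ρ)), r ∈ Ioo ε ρ ∧ (r ≤ ρ →
      interiorSq (residual R B p (splice ρ U V)) r ≤
        nodeBound B h₀ N * (volterraConst ε R B K h₀ κ Λ N *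
          ∫ t in r..R, sumSq (splice ρ U V - U) t)) := by
    rw [← restrict_Ioo_eq_restrict_Icc]
    exact (ae_restrict_mem measurableSet_Ioo).and (ae_restrict_of_ae_restrict_of_subset
      (Ioo_subset_Ioo_right hρ.2) (hS.ae_interiorSq_residual_splice_le hp hU hsol hW))
  filter_upwards [hsub] with r hr
  have h1 := integral_sumSq_splice_sub_le hεR hU.memH hV.memH hρ ⟨hr.1.1.le, hr.1.2.le⟩
  refine mul_le_mul_of_nonneg_right ((hr.2 hr.1.2.le).trans ?_) (Real.exp_pos _).le
  rw [← mul_assoc]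
  exact mul_le_mul_of_nonneg_left (h1.trans (by linarith))
    (mul_nonneg hS.nodeBound_nonneg (sq_nonneg _))

end Residual

/-! ### Noise on the faces and stability of the minimizers -/

/-- On the faces `V - U` and `P - Q` have the same traces; this is the only way in which the
extensions enter the estimates. -/
theorem integral_faceSq_sub_le {ε R : ℝ} (hεR : ε ≤ R) {V U P Q : SemiDiscrete N n k}
    {G₀ G_B G₀' G_B' : FaceData N n} (hP : InH1h ε R P) (hQ : InH1h ε R Q)
    (hV : HasFaceData ε R G₀ G_B V) (hU : HasFaceData ε R G₀' G_B' U)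
    (hPG : HasFaceData ε R G₀ G_B P) (hQG : HasFaceData ε R G₀' G_B' Q) (B : ℝ) :
    ∫ r in ε..R, faceSq (V - U) r ≤ normH1h ε R B (P - Q) ^ 2 := by
  have hd := hP.sub hQ
  have hRR : R ∈ Icc ε R := ⟨hεR, le_rfl⟩
  have hεε : ε ∈ Icc ε R := ⟨le_rfl, hεR⟩
  have hae : ∀ᵐ r ∂(volume.restrict (Ioo ε R)), faceSq (V - U) r = faceSq (P - Q) r := by
    have h : ∀ i s, ∀ᵐ r ∂(volume.restrict (Ioo ε R)),
        (V - U) i 0 s r = (P - Q) i 0 s r ∧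
        (V - U) i (Fin.last k) s r = (P - Q) i (Fin.last k) s r := by
      intro i s
      filter_upwards [(hV i s).1, (hU i s).1, (hPG i s).1, (hQG i s).1, (hV i s).2, (hU i s).2,
        (hPG i s).2, (hQG i s).2] with r a1 a2 a3 a4 b1 b2 b3 b4
      simp only [Pi.sub_apply, a1, a2, a3, a4, b1, b2, b3, b4, and_self]
    filter_upwards [ae_all_iff.2 fun i => ae_all_iff.2 fun s => h i s] with r hr
    refine Finset.sum_congr rfl fun i _ => Finset.sum_congr rfl fun j _ => ?_
    split_ifs with hj
    · rfl
    · refine Finset.sum_congr rfl fun s _ => ?_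
      rw [IsInteriorZ, not_and_or, not_not, not_not] at hj
      rcases hj with rfl | rfl
      · rw [(hr i s).1]
      · rw [(hr i s).2]
  refine le_trans ?_ (hd.integral_sumSq_le hεR B)
  have e : ∫ r in ε..R, faceSq (V - U) r = ∫ r in ε..R, faceSq (P - Q) r := by
    simp only [intervalIntegral.integral_of_le hεR, integral_Ioc_eq_integral_Ioo]
    exact integral_congr_ae hae
  rw [e]
  exact intervalIntegral.integral_mono_on hεR
    (intervalIntegrable_of_integrable_Ioo hεR (integrable_faceSq hd) hεε hRR)
    (intervalIntegrable_of_integrable_Ioo hεR hd.integrable_sumSq hεε hRR)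
    fun r _ => faceSq_le_sumSq _ r

theorem admissible_isRegular {ε R B M : ℝ} (hεR : ε ≤ R) {G₀ G_B : FaceData N n}
    {V : SemiDiscrete N n k} (hV : V ∈ admissible ε R B M k G₀ G_B) :
    IsRegular ε R B (2 * M ^ 2 + 2) V := by
  refine ⟨hV.1, hV.2.1, (hV.1.integral_sumSq_le hεR B).trans ?_⟩
  have h1 := hV.2.2.1
  have h2 : 0 ≤ normH1h ε R B V := normH1h_nonneg _
  nlinarith

theorem IsRegular.mono {ε R B K K' : ℝ} {V : SemiDiscrete N n k} (hV : IsRegular ε R B K V)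
    (h : K ≤ K') : IsRegular ε R B K' V := ⟨hV.memH, hV.lower, hV.bound.trans h⟩

/-- The competitor is admissible when it is close enough to the exact solution. -/
theorem splice_mem_admissible {ε R B M ρ K : ℝ} (hεR : ε ≤ R) {G₀ G_B G₀' G_B' : FaceData N n}
    {V U : SemiDiscrete N n k} (hV : IsRegular ε R B K V)
    (hVG : HasFaceData ε R G₀ G_B V) (hVP : IsPeriodicPhi ε R V)
    (hU : U ∈ admissible ε R B M k G₀' G_B')
    (hnorm : normH1h ε R B U + normH1h ε R B (splice ρ U V - U) < M) :
    splice ρ U V ∈ admissible ε R B M k G₀ G_B := by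
  have hmem := hU.1.splice hV.memH ρ
  refine ⟨hmem, fun i j => lower_splice (hU.2.1 i j) (hV.lower i j), ?_, fun i s => ⟨?_, ?_⟩,
    fun j s => ?_⟩
  · have h := hU.1.normH1h_add_le hεR B (hmem.sub hU.1)
    rw [add_sub_cancel] at h
    exact h.trans_lt hnorm
  · filter_upwards [(hVG i s).1] with r hr
    rw [splice_of_face fun h => h.1 rfl, hr]
  · filter_upwards [(hVG i s).2] with r hr
    rw [splice_of_face fun h => h.2 rfl, hr]
  · filter_upwards [hVP j s, hU.2.2.2.2 j s] with r h1 h2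
    simp only [splice, h1, h2]

/-- Lipschitz stability of the minimizers, for all `M` up to a given bound. -/
theorem exists_stability_constants (ε R B h₀ Λ Mb : ℝ) (N : ℕ) (hε : 0 < ε) (hεR : ε < R)
    (hB : 0 < B) (hh₀ : 0 < h₀) :
    ∃ C > 0, ∃ lam₀ ≥ 1, ∀ M > 0, M ≤ Mb →
      ∀ n k : ℕ, 1 ≤ n → 1 ≤ k → h₀ ≤ stepPhi n → h₀ ≤ stepZ B k →
      ∀ p : Fin N → ℝ → ℝ → ℝ, IsTravelTimeData B Λ p →
      ∀ (G₀ G_B G₀ex G_Bex : FaceData N n) (P Pex Vex : SemiDiscrete N n k) (δ α : ℝ),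
        0 < δ → InH1h ε R P → InH1h ε R Pex →
        HasFaceData ε R G₀ G_B P → HasFaceData ε R G₀ex G_Bex Pex →
        normH1h ε R B (P - Pex) < δ →
        Vex ∈ admissible ε R B M k G₀ex G_Bex →
        SolvesEquation ε R B p Vex → C * δ < α → normH1h ε R B Vex < M - α →
        ∀ lam, lam₀ ≤ lam → ∀ V ∈ closureH1h ε R B (admissible ε R B M k G₀ G_B),
          IsMinOn (functionalJ ε R B p lam) (closureH1h ε R B (admissible ε R B M k G₀ G_B)) V →
          normH1h ε R B (V - Vex) ≤ C * δ := by
  obtain ⟨κ, hκ⟩ : ∃ κ, BoundsBasis B N κ := exists_bound_Psi B N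
  obtain ⟨α₀, hα₀, hα⟩ := exists_sum_sq_le_mulVec_basisMatrix hB N
  set K := 2 * Mb ^ 2 + 2 with hKdef
  have hK : 0 ≤ K := by positivity
  set Q := nodeBound B h₀ N with hQdef
  have hQ : 0 ≤ Q := by
    have := Real.pi_pos
    rw [hQdef, nodeBound]
    positivity
  set Cv := volterraConst ε R B K h₀ κ Λ N with hCvdef
  have hCv : 0 ≤ Cv := sq_nonneg _
  -- The three summands are the constants of the residual term, of the Volterra term and of the
  -- comparison with the competitor, so `Kf` dominates each of them.
  set Kf := 2 * α₀ + 2 * α₀ * (Q * Cv) + Q * Cv with hKfdef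
  have hKf : 0 ≤ Kf := by positivity
  set L := gronwallFactor ε R Kf with hLdef
  have hL : 0 < L := gronwallFactor_pos _ _ _
  set Cg := 2 * (Q / h₀ ^ 2) + 1 with hCgdef
  have hCg : 0 < Cg := by positivity
  -- `L` bounds the growth of the squared error relative to `δ²`, and `Cg` passes from the `L₂` norm
  -- to the full norm. The threshold `max 1 Kf` is what the Gronwall argument requires of `λ`.
  refine ⟨√(Cg * L), Real.sqrt_pos.2 (mul_pos hCg hL), max 1 Kf, le_max_left _ _, ?_⟩
  intro M hM hMb n k hn hk hφ hz p hp G₀ G_B G₀ex G_Bex P Pex Vex δ α hδ hP hPex hPG hPexG hPP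
    hVex hsol hCα hVexα lam hlam V hV hmin
  have hS : Setting ε R B h₀ κ N n k := ⟨hε, hεR, hB, hh₀, hκ, hn, hk, hφ, hz⟩
  have hRR : R ∈ Icc ε R := ⟨hεR.le, le_rfl⟩
  have hεε : ε ∈ Icc ε R := ⟨le_rfl, hεR.le⟩
  have hMK : 2 * M ^ 2 + 2 ≤ K := by rw [hKdef]; nlinarith
  obtain ⟨hVreg', hVG, hVP⟩ := closure_isRegular hεR.le hκ hV
  have hVreg := hVreg'.mono hMK
  have hUreg := (admissible_isRegular hεR.le hVex).mono hMK
  have hd := hVreg.memH.sub hUreg.memH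
  have hface : ∫ r in ε..R, faceSq (V - Vex) r ≤ δ ^ 2 := by
    refine (integral_faceSq_sub_le hεR.le hP hPex hVG hVex.2.2.2.1 hPG hPexG B).trans ?_
    exact pow_le_pow_left₀ (normH1h_nonneg _) hPP.le 2
  set f := interiorSq (V - Vex) with hf
  set q := interiorSq (residual R B p V) with hq
  have hfi : Integrable f (volume.restrict (Ioo ε R)) :=
    integrable_interiorSq fun i j s _ => hd i j s
  have hqi : Integrable q (volume.restrict (Ioo ε R)) :=
    integrable_interiorSq fun i j m hj => hS.memLp_residual hK hp hVreg i hj m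
  have hfaceI := integrable_faceSq hd
  have hnorm_of : ∀ {F : SemiDiscrete N n k}, InH1h ε R F →
      ∫ r in ε..R, sumSq F r ≤ L * δ ^ 2 → normH1h ε R B F ≤ √(Cg * L) * δ := by
    intro F hF h
    refine le_of_sq_le_sq ?_ (by positivity)
    rw [mul_pow, Real.sq_sqrt (by positivity)]
    refine (hS.normH1h_sq_le hF).trans ?_
    rw [mul_assoc]
    exact mul_le_mul_of_nonneg_left h hCg.le
  have hgron := integral_le_gronwallFactor (lam := lam) hεR.le hKf (sq_nonneg δ)
    ((le_max_left _ _).trans hlam) ((le_max_right _ _).trans hlam)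
    (intervalIntegrable_of_integrable_Ioo hεR.le hfi hεε hRR)
    (intervalIntegrable_of_integrable_Ioo hεR.le hqi hεε hRR)
    (fun r => interiorSq_nonneg _ r) ?_ ?_
  · refine hnorm_of hd ?_
    have e : ∫ r in ε..R, sumSq (V - Vex) r =
        (∫ r in ε..R, f r) + ∫ r in ε..R, faceSq (V - Vex) r := by
      rw [← intervalIntegral.integral_add
        (intervalIntegrable_of_integrable_Ioo hεR.le hfi hεε hRR)
        (intervalIntegrable_of_integrable_Ioo hεR.le hfaceI hεε hRR)]
      simp only [sumSq_eq_add, hf]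
    rw [e]
    linarith
  · filter_upwards [hS.ae_interiorSq_sub_le hp hVreg hUreg hsol hα₀ hα,
      ae_restrict_mem measurableSet_Ioo] with r hr hmem
    have hrI := Ioo_subset_Icc_self hmem
    have e : ∫ t in r..R, sumSq (V - Vex) t =
        (∫ t in r..R, f t) + ∫ t in r..R, faceSq (V - Vex) t := by
      rw [← intervalIntegral.integral_add
        (intervalIntegrable_of_integrable_Ioo hεR.le hfi hrI hRR)
        (intervalIntegrable_of_integrable_Ioo hεR.le hfaceI hrI hRR)]
      simp only [sumSq_eq_add, hf]
    have e2 := intervalIntegral.integral_add_adjacent_intervals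
      (intervalIntegrable_of_integrable_Ioo hεR.le hfaceI hεε hrI)
      (intervalIntegrable_of_integrable_Ioo hεR.le hfaceI hrI hRR)
    have e3 : 0 ≤ ∫ t in ε..r, faceSq (V - Vex) t :=
      intervalIntegral.integral_nonneg hrI.1 fun t _ => faceSq_nonneg _ t
    have e4 : 0 ≤ ∫ t in r..R, f t :=
      intervalIntegral.integral_nonneg hrI.2 fun t _ => interiorSq_nonneg _ t
    have hE : ∫ t in r..R, sumSq (V - Vex) t ≤ δ ^ 2 + ∫ t in r..R, f t := by linarith
    have hq0 : 0 ≤ q r := interiorSq_nonneg _ r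
    set E := δ ^ 2 + ∫ t in r..R, f t with hEdef
    have hE0 : 0 ≤ E := by positivity
    calc f r ≤ α₀ * (2 * q r + 2 * (Q * (Cv * E))) := by
          refine hr.trans ?_
          gcongr
      _ = 2 * α₀ * q r + 2 * α₀ * (Q * Cv) * E := by ring
      _ ≤ Kf * q r + Kf * E := by
          have hx : 0 ≤ 2 * α₀ * (Q * Cv) := by positivity
          have hy : 0 ≤ Q * Cv := by positivity
          gcongr <;> rw [hKfdef] <;> linarith
      _ = Kf * (q r + δ ^ 2 + ∫ t in r..R, f t) := by rw [hEdef]; ring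
  · intro ρ hρ hρL
    have hWsub : normH1h ε R B (splice ρ Vex V - Vex) ≤ √(Cg * L) * δ := by
      refine hnorm_of ((hUreg.memH.splice hVreg.memH ρ).sub hUreg.memH) ?_
      refine (integral_sumSq_splice_sub_le hεR.le hUreg.memH hVreg.memH hρ
        ⟨le_rfl, hρ.1⟩).trans ?_
      linarith
    -- Here `C * δ < α` is used: the norm of the competitor is at most `‖V*‖ + C δ < M - α + C δ <
    -- M`.
    have hWadm : splice ρ Vex V ∈ admissible ε R B M k G₀ G_B :=
      splice_mem_admissible hεR.le hVreg hVG hVP hVex (by linarith)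
    have hJ : functionalJ ε R B p lam V ≤ functionalJ ε R B p lam (splice ρ Vex V) :=
      hmin (subset_closureH1h (fun _ h => h.1) hWadm)
    refine (hS.integral_residual_le_of_functionalJ_le hK hp hVreg hUreg hsol hρ
      ((admissible_isRegular hεR.le hWadm).mono hMK) hface hJ).trans ?_
    have h1 : 0 ≤ δ ^ 2 + ∫ r in ρ..R, f r := add_nonneg (sq_nonneg _)
      (intervalIntegral.integral_nonneg hρ.2 fun t _ => interiorSq_nonneg _ t)
    have h2 : 0 ≤ ∫ r in ε..ρ, Real.exp (2 * lam * r) :=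
      intervalIntegral.integral_nonneg hρ.1 fun t _ => (Real.exp_pos _).le
    have h3 : Q * Cv ≤ Kf := by
      have : 0 ≤ 2 * α₀ * (Q * Cv) := by positivity
      rw [hKfdef]
      linarith
    gcongr

end TravelTime

end

theorem theorem8p2 (ε R B h₀ Λ : ℝ) (N : ℕ) (hε : 0 < ε) (hεR : ε < R) (hB : 0 < B)
    (hh₀ : 0 < h₀) (hN : 1 ≤ N) :
    ∃ lam₀ : ℝ → ℝ, Monotone lam₀ ∧ (∀ M, 1 ≤ lam₀ M) ∧
      ∀ M > 0, ∃ C > 0,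
        ∀ n k : ℕ, 1 ≤ n → 1 ≤ k →
          h₀ ≤ TravelTime.stepPhi n → h₀ ≤ TravelTime.stepZ B k →
        ∀ p : Fin N → ℝ → ℝ → ℝ, TravelTime.IsTravelTimeData B Λ p →
        ∀ (G₀ G_B G₀ex G_Bex : TravelTime.FaceData N n)
          (P Pex Vex : TravelTime.SemiDiscrete N n k) (δ α : ℝ),
          -- the noise level and the extensions of the noisy and of the noiseless data
          δ ∈ Set.Ioo 0 1 →
          TravelTime.InH1h ε R P → TravelTime.InH1h ε R Pex →
          TravelTime.HasFaceData ε R G₀ G_B P → TravelTime.HasFaceData ε R G₀ex G_Bex Pex →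
          TravelTime.normH1h ε R B P < M → TravelTime.normH1h ε R B Pex < M →
          TravelTime.normH1h ε R B (P - Pex) < δ →
          -- the exact solution
          Vex ∈ TravelTime.admissible ε R B M k G₀ex G_Bex →
          TravelTime.SolvesEquation ε R B p Vex →
          α ∈ Set.Ioo 0 M → C * δ < α →
          TravelTime.normH1h ε R B Vex < M - α →
        ∀ lam, lam₀ (2 * M) ≤ lam →
        ∀ V ∈ TravelTime.closureH1h ε R B (TravelTime.admissible ε R B M k G₀ G_B),
          IsMinOn (TravelTime.functionalJ ε R B p lam)
            (TravelTime.closureH1h ε R B (TravelTime.admissible ε R B M k G₀ G_B)) V →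
          TravelTime.normH1h ε R B (V - Vex) ≤ C * δ := by
  have hcore := fun m : ℕ =>
    TravelTime.exists_stability_constants ε R B h₀ Λ m N hε hεR hB hh₀
  choose C hC lam₁ hlam₁ H using hcore
  have hlam0 : ∀ m, 0 ≤ lam₁ m := fun m => zero_le_one.trans (hlam₁ m)
  -- The constants are chosen for each integer bound on the radius. Summing the thresholds up to
  -- `⌈M⌉₊` makes the result monotone and at least each summand; the value at `2 * M` then contains
  -- the summand `⌈M⌉₊`, which is the one needed.
  refine ⟨fun M => ∑ m ∈ Finset.range (⌈M⌉₊ + 1), lam₁ m, fun M M' h => ?_, fun M => ?_,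
    fun M hM => ⟨C ⌈M⌉₊, hC _, ?_⟩⟩
  · refine Finset.sum_le_sum_of_subset_of_nonneg ?_ fun m _ _ => hlam0 m
    exact Finset.range_subset_range.2 (by have := Nat.ceil_mono h; omega)
  · exact (hlam₁ 0).trans (Finset.single_le_sum (fun m _ => hlam0 m) (by simp))
  · intro n k hn hk hφ hz p hp G₀ G_B G₀ex G_Bex P Pex Vex δ α hδ hP hPex hPG hPexG _ _ hPP
      hVex hsol _ hCα hVexα lam hlam V hV hmin
    refine H ⌈M⌉₊ M hM (Nat.le_ceil M) n k hn hk hφ hz p hp G₀ G_B G₀ex G_Bex P Pex Vex δ α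
      hδ.1 hP hPex hPG hPexG hPP hVex hsol hCα hVexα lam (le_trans ?_ hlam) V hV hmin
    refine Finset.single_le_sum (fun m _ => hlam0 m) (Finset.mem_range.2 ?_)
    have : ⌈M⌉₊ ≤ ⌈2 * M⌉₊ := Nat.ceil_mono (by linarith)
    omega
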